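/- Let $n\in\{1,2\}$, let $\Omega\subset\mathbb{R}^n$ be a bounded open set, $\alpha>0$, $T>0$, $I=(0,T)$, and let $r>3$ be an integer. Write $(\cdot,\cdot)$ and $\|\cdot\|$ for the inner product and norm of $L^2(\Omega)$. Let $H^2(\Omega)$ be the space of all $v\in L^2(\Omega)$ with weak derivatives $\nabla v,\Delta v\in L^2(\Omega)$, with the norm $\|v\|_2=(\|v\|^2+\|\nabla v\|^2+\|\Delta v\|^2)^{1/2}$, let $H^2_0(\Omega)$ be the closure of $C_c^\infty(\Omega)$ in $H^2(\Omega)$, and let $\|\cdot\|_r$ be the norm of the standard Sobolev space $H^r(\Omega)$. Let $g:\mathbb{R}\to\mathbb{R}^n$, $g_i(s)=-(s+\tfrac12 s^2)$ for $i=1,\dots,n$. **Weak solution.** $u\in L^\infty(I;H^2_0(\Omega))$ with $u_t\in L^2(I;H^2(\Omega))$ (taken as the representative continuous on $[0,T]$) is a weak solution with initial value $u_0$ if $u(0)=u_0$ and, for almost every $t\in I$, $$(u_t(t),\chi)+(\Delta u_t(t),\Delta\chi)+\alpha(\nabla u(t),\nabla\chi)=(\nabla\cdot g(u(t)),\chi)\qquad\text{for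 all }\chi\in H^2_0(\Omega).$$ **Discrete spaces.** Fix $K>0$. For $0<h<1$, let $S_h$ denote a finite-dimensional subspace of $H_0^2(\Omega)$ of order of accuracy $r$, that is, $$\inf_{\phi\in S_h}\|v-\phi\|_2\le K h^{r-2}\|v\|_r\qquad\text{for all }v\in H^2_0(\Omega)\cap H^r(\Omega).$$ Let $\Pi_h v\in S_h$ be the projection with $(\Delta(v-\Pi_h v),\Delta\chi)=0$ for all $\chi\in S_h$. **Scheme.** For an integer $N\ge1$ put $k=T/N$ and $t^m=mk$. A solution of the backward Euler scheme is a sequence $U^0,\dots,U^N\in S_h$ with $U^0=\Pi_hu_0$ and, with $\delta_tU^m=(U^m-U^{m-1})/k$, $$(\delta_tU^m,\chi)+(\Delta\delta_tU^m,\Delta\chi)+\alpha(\nabla U^m,\nabla\chi)=-(g(U^m),\nabla\chi)\qquad\text{for all }\chi\in S_h,\ 1\le m\le N.$$ **Theorem.** For every $R$ there is a constant $K_1>0$, depending only on $n,\Omega,\alpha,T,r,K,R$, such that the following holds. Let $u$ be a weak solution with $\|u_0\|_2\le R$, $u\in L^2(I;H^r(\Omega))$, $u_0\in H^2_0(\Omega)\cap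 H^r(\Omega)$, $u_t\in L^1(I;H^r(\Omega))$ and $u_{tt}\in L^1(I;H^2(\Omega))$. Then for all $h\in(0,1)$, all such $S_h$, all $N\ge1$ and every solution $U^0,\dots,U^N$ of the scheme, $$\Big(\sum_{m=0}^N\|u(t^m)-U^m\|_2^2\Big)^{1/2}\le K_1\Big(\sum_{m=1}^N\|u(t^m)\|_r+\int_0^T\|u_t(s)\|_r\,ds+\int_0^T\|u_{tt}(s)\|_2\,ds\Big)\,(h^{r-2}+k).$$ Moreover, for each such $u$ there is a constant $K_2>0$, independent of $h$, $S_h$, $N$ and $U$, such that under the same conditions $$\max_{0\le m\le N}\|u(t^m)-U^m\|_2\le K_2\,(h^{r-2}+k).$$ -/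

import Mathlib

open MeasureTheory Set Filter
open scoped ContDiff Topology RealInnerProductSpace

namespace RosenauBurgers

noncomputable section

/-- The space `ℝⁿ` with its Euclidean norm. -/
abbrev E (n : ℕ) : Type := EuclideanSpace ℝ (Fin n)

/-- The `i`-th unit vector of `ℝⁿ`. -/
def e {n : ℕ} (i : Fin n) : E n := EuclideanSpace.single i 1

/-- `L²(Ω)`. -/
abbrev L2 {n : ℕ} (Ω : Set (E n)) : Type := Lp ℝ 2 (volume.restrict Ω)

/-- Test functions: `φ ∈ C_c^∞(Ω)`. -/
def IsTest {n : ℕ} (Ω : Set (E n)) (φ : E n → ℝ) : Prop :=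
  ContDiff ℝ ∞ φ ∧ HasCompactSupport φ ∧ tsupport φ ⊆ Ω

/-- The classical partial derivative `∂_{σ 0} ⋯ ∂_{σ (m-1)} φ` of order `m`. -/
def partialD {n m : ℕ} (σ : Fin m → Fin n) (φ : E n → ℝ) (x : E n) : ℝ :=
  iteratedFDeriv ℝ m φ x (fun j => e (σ j))

/-- `w = ∂_{σ 0} ⋯ ∂_{σ (m-1)} v` in `Ω`, in the weak sense. -/
def IsWeakD {n m : ℕ} (Ω : Set (E n)) (σ : Fin m → Fin n) (v w : E n → ℝ) : Prop :=
  ∀ φ, IsTest Ω φ →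
    ∫ x in Ω, v x * partialD σ φ x = (-1) ^ m * ∫ x in Ω, w x * φ x

/-- `w = Δ v` in `Ω`, in the weak sense. -/
def IsWeakLaplacian {n : ℕ} (Ω : Set (E n)) (v w : E n → ℝ) : Prop :=
  ∀ φ, IsTest Ω φ →
    ∫ x in Ω, v x * Laplacian.laplacian φ x = ∫ x in Ω, w x * φ x

/-- `w = ∇ · F` in `Ω`, in the weak sense. -/
def IsWeakDiv {n : ℕ} (Ω : Set (E n)) (F : E n → E n) (w : E n → ℝ) : Prop :=
  ∀ φ, IsTest Ω φ →
    ∫ x in Ω, ∑ i, F x i * fderiv ℝ φ x (e i) = -∫ x in Ω, w x * φ x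

/-! ### Helper facts: the weak derivatives of `L²` functions are linear -/

theorem integrable_mul_cc {n : ℕ} {Ω : Set (E n)} (v : L2 Ω) {ψ : E n → ℝ}
    (hc : Continuous ψ) (hs : HasCompactSupport ψ) :
    Integrable (fun x => v x * ψ x) (volume.restrict Ω) := by
  have h1 : MemLp ψ 2 (volume.restrict Ω) := hc.memLp_of_hasCompactSupport hs
  exact (Lp.memLp v).integrable_mul h1

/-- A weak identity `∫ v Pφ = c ∫ w φ` for all test functions is preserved by sums. -/
theorem weak_add {n : ℕ} {Ω : Set (E n)} {ψ φ : E n → ℝ} {c : ℝ} {v v' w w' : L2 Ω}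
    (hψ : Continuous ψ) (hψs : HasCompactSupport ψ)
    (hφ : Continuous φ) (hφs : HasCompactSupport φ)
    (h : ∫ x in Ω, v x * ψ x = c * ∫ x in Ω, w x * φ x)
    (h' : ∫ x in Ω, v' x * ψ x = c * ∫ x in Ω, w' x * φ x) :
    ∫ x in Ω, (v + v') x * ψ x = c * ∫ x in Ω, (w + w') x * φ x := by
  have e1 : ∫ x in Ω, (v + v') x * ψ x = ∫ x in Ω, (v x * ψ x + v' x * ψ x) := by
    refine integral_congr_ae ?_
    filter_upwards [Lp.coeFn_add v v'] with x hx
    rw [hx, Pi.add_apply, add_mul]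
  have e2 : ∫ x in Ω, (w + w') x * φ x = ∫ x in Ω, (w x * φ x + w' x * φ x) := by
    refine integral_congr_ae ?_
    filter_upwards [Lp.coeFn_add w w'] with x hx
    rw [hx, Pi.add_apply, add_mul]
  rw [e1, e2, integral_add (integrable_mul_cc v hψ hψs) (integrable_mul_cc v' hψ hψs),
    integral_add (integrable_mul_cc w hφ hφs) (integrable_mul_cc w' hφ hφs), h, h', mul_add]

theorem weak_smul {n : ℕ} {Ω : Set (E n)} {ψ φ : E n → ℝ} {c : ℝ} {v w : L2 Ω} (a : ℝ)
    (h : ∫ x in Ω, v x * ψ x = c * ∫ x in Ω, w x * φ x) :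
    ∫ x in Ω, (a • v) x * ψ x = c * ∫ x in Ω, (a • w) x * φ x := by
  have e1 : ∫ x in Ω, (a • v) x * ψ x = ∫ x in Ω, a * (v x * ψ x) := by
    refine integral_congr_ae ?_
    filter_upwards [Lp.coeFn_smul a v] with x hx
    rw [hx, Pi.smul_apply, smul_eq_mul, mul_assoc]
  have e2 : ∫ x in Ω, (a • w) x * φ x = ∫ x in Ω, a * (w x * φ x) := by
    refine integral_congr_ae ?_
    filter_upwards [Lp.coeFn_smul a w] with x hx
    rw [hx, Pi.smul_apply, smul_eq_mul, mul_assoc]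
  rw [e1, e2, integral_const_mul, integral_const_mul, h]
  ring

theorem weak_zero {n : ℕ} {Ω : Set (E n)} {ψ φ : E n → ℝ} {c : ℝ} :
    ∫ x in Ω, (0 : L2 Ω) x * ψ x = c * ∫ x in Ω, (0 : L2 Ω) x * φ x := by
  have key : ∀ θ : E n → ℝ, ∫ x in Ω, (0 : L2 Ω) x * θ x = 0 := by
    intro θ
    rw [← integral_zero (E n) ℝ (μ := volume.restrict Ω)]
    refine integral_congr_ae ?_
    filter_upwards [Lp.coeFn_zero ℝ 2 (volume.restrict Ω)] with x hx
    rw [hx, Pi.zero_apply, zero_mul]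
  rw [key, key, mul_zero]

theorem partialD_continuous {n m : ℕ} {Ω : Set (E n)} (σ : Fin m → Fin n) {φ : E n → ℝ}
    (h : IsTest Ω φ) : Continuous (partialD σ φ) := by
  have h1 : Continuous (iteratedFDeriv ℝ m φ) :=
    h.1.continuous_iteratedFDeriv (by exact_mod_cast le_top)
  exact (ContinuousMultilinearMap.apply ℝ (fun _ : Fin m => E n) ℝ
    (fun j => e (σ j))).continuous.comp h1

theorem partialD_compact {n m : ℕ} {Ω : Set (E n)} (σ : Fin m → Fin n) {φ : E n → ℝ}
    (h : IsTest Ω φ) : HasCompactSupport (partialD σ φ) := by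
  refine (h.2.1.iteratedFDeriv (𝕜 := ℝ) m).mono ?_
  intro x hx hx'
  exact hx (by simp [partialD, hx'])

theorem fderiv_eq_partialD {n : ℕ} (i : Fin n) (φ : E n → ℝ) :
    (fun x => fderiv ℝ φ x (e i)) = partialD (fun _ : Fin 1 => i) φ := by
  funext x
  simp [partialD, iteratedFDeriv_one_apply]

theorem laplacian_eq_partialD {n : ℕ} (φ : E n → ℝ) :
    Laplacian.laplacian φ = fun x => ∑ i, partialD (fun _ : Fin 2 => i) φ x := by
  rw [InnerProductSpace.laplacian_eq_iteratedFDeriv_orthonormalBasis φ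
    (EuclideanSpace.basisFun (Fin n) ℝ)]
  funext x
  refine Finset.sum_congr rfl fun i _ => ?_
  unfold partialD
  congr 1
  funext j
  fin_cases j <;> simp [e]

theorem laplacian_continuous {n : ℕ} {Ω : Set (E n)} {φ : E n → ℝ}
    (h : IsTest Ω φ) : Continuous (Laplacian.laplacian φ) := by
  rw [laplacian_eq_partialD]
  exact continuous_finsetSum _ fun i _ => partialD_continuous _ h

theorem laplacian_compact {n : ℕ} {Ω : Set (E n)} {φ : E n → ℝ}
    (h : IsTest Ω φ) : HasCompactSupport (Laplacian.laplacian φ) := by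
  refine (h.2.1.iteratedFDeriv (𝕜 := ℝ) 2).mono ?_
  intro x hx hx'
  refine hx ?_
  rw [laplacian_eq_partialD]
  simp [partialD, hx']

/-! ### The Sobolev spaces -/

/-- The indices of the partial derivatives of order at most `r` in `ℝⁿ`. -/
abbrev Idx (n r : ℕ) : Type := Σ m : Fin (r + 1), (Fin m → Fin n)

/-- The index of the derivative of order `0`. -/
def Idx.zero {n r : ℕ} : Idx n r := ⟨0, fun j => j.elim0⟩

/-- The standard Sobolev space `H^r(Ω)`: an element is the family of all weak partial derivatives
of order at most `r` of an `L²` function (the component of order `0`), all of them in `L²(Ω)`.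
The norm is `‖v‖_r² = ∑_{m ≤ r} ∑_{i₁, …, i_m} ‖∂_{i₁} ⋯ ∂_{i_m} v‖²`. -/
def Hr {n : ℕ} (r : ℕ) (Ω : Set (E n)) : Submodule ℝ (PiLp 2 (fun _ : Idx n r => L2 Ω)) where
  carrier := {f | ∀ a : Idx n r, IsWeakD Ω a.2 (f Idx.zero) (f a)}
  add_mem' := by
    intro f f' hf hf' a φ hφ
    exact weak_add (partialD_continuous _ hφ) (partialD_compact _ hφ) hφ.1.continuous hφ.2.1
      (hf a φ hφ) (hf' a φ hφ)
  zero_mem' := by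
    intro a φ hφ
    exact weak_zero
  smul_mem' := by
    intro c f hf a φ hφ
    exact weak_smul c (hf a φ hφ)

/-- The underlying `L²` function of an element of `H^r(Ω)`. -/
def fnR {n r : ℕ} {Ω : Set (E n)} (w : Hr r Ω) : L2 Ω := w.1 Idx.zero

/-- Indices of the components `v`, `∂_i v`, `Δ v`. -/
abbrev Slot (n : ℕ) : Type := Unit ⊕ Fin n ⊕ Unit

/-- The space `H²(Ω)` with the norm `‖v‖_2² = ‖v‖² + ‖∇v‖² + ‖Δv‖²`: an element consists of an
`L²` function `v`, its weak gradient and its weak Laplacian, all of them in `L²(Ω)`. -/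
def H2 {n : ℕ} (Ω : Set (E n)) : Submodule ℝ (PiLp 2 (fun _ : Slot n => L2 Ω)) where
  carrier := {f | (∀ i : Fin n, IsWeakD Ω (fun _ : Fin 1 => i) (f (.inl ())) (f (.inr (.inl i)))) ∧
    IsWeakLaplacian Ω (f (.inl ())) (f (.inr (.inr ())))}
  add_mem' := by
    intro f f' hf hf'
    refine ⟨fun i φ hφ => ?_, fun φ hφ => ?_⟩
    · exact weak_add (partialD_continuous _ hφ) (partialD_compact _ hφ) hφ.1.continuous hφ.2.1
        (hf.1 i φ hφ) (hf'.1 i φ hφ)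
    · have h := hf.2 φ hφ
      have h' := hf'.2 φ hφ
      rw [← one_mul (∫ x in Ω, _ * φ x)] at h h' ⊢
      exact weak_add (laplacian_continuous hφ) (laplacian_compact hφ) hφ.1.continuous hφ.2.1 h h'
  zero_mem' := by
    refine ⟨fun i φ hφ => weak_zero, fun φ hφ => ?_⟩
    rw [← one_mul (∫ x in Ω, _ * φ x)]
    exact weak_zero
  smul_mem' := by
    intro c f hf
    refine ⟨fun i φ hφ => weak_smul c (hf.1 i φ hφ), fun φ hφ => ?_⟩
    have h := hf.2 φ hφ
    rw [← one_mul (∫ x in Ω, _ * φ x)] at h ⊢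
    exact weak_smul c h

/-- The underlying `L²` function `v` of an element of `H²(Ω)`. -/
def fn {n : ℕ} {Ω : Set (E n)} (v : H2 Ω) : L2 Ω := v.1 (.inl ())

/-- The weak partial derivative `∂_i v`. -/
def grad {n : ℕ} {Ω : Set (E n)} (v : H2 Ω) (i : Fin n) : L2 Ω := v.1 (.inr (.inl i))

/-- The weak Laplacian `Δ v`. -/
def lap {n : ℕ} {Ω : Set (E n)} (v : H2 Ω) : L2 Ω := v.1 (.inr (.inr ()))

theorem norm_sq_eq {n : ℕ} {Ω : Set (E n)} (v : H2 Ω) :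
    ‖v‖ ^ 2 = ‖fn v‖ ^ 2 + ∑ i, ‖grad v i‖ ^ 2 + ‖lap v‖ ^ 2 := by
  have h : ‖v‖ ^ 2 = ∑ s, ‖v.1 s‖ ^ 2 := PiLp.norm_sq_eq_of_L2 _ v.1
  rw [h, Fintype.sum_sum_type, Fintype.sum_sum_type]
  simp [fn, grad, lap, add_assoc]

/-- `H²₀(Ω)`: the closure of `C_c^∞(Ω)` in `H²(Ω)`. -/
def H20 {n : ℕ} (Ω : Set (E n)) : Submodule ℝ (H2 Ω) :=
  (Submodule.span ℝ {f : H2 Ω | ∃ φ, IsTest Ω φ ∧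
    (fn f : E n → ℝ) =ᵐ[volume.restrict Ω] φ}).topologicalClosure

/-- The norm `‖v‖_r` of an `L²` function `v` that belongs to `H^r(Ω)` (an element of `H^r(Ω)` is
determined by its underlying function, so the set below has exactly one element then). -/
def sobNorm {n : ℕ} {Ω : Set (E n)} (r : ℕ) (v : L2 Ω) : ℝ :=
  sInf {a | ∃ w : Hr r Ω, fnR w = v ∧ a = ‖w‖}

/-! ### Functions of time -/

/-- Lebesgue measure on the time interval `I = (0, T)`. -/
def timeMeasure (T : ℝ) : Measure ℝ := volume.restrict (Ioo 0 T)

/-- `v ∈ L^p(I; H^r(Ω))`. -/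
def MemLpHr {n : ℕ} {Ω : Set (E n)} (T : ℝ) (p : ENNReal) (r : ℕ) (v : ℝ → H2 Ω) : Prop :=
  ∃ w : ℝ → Hr r Ω, MemLp w p (timeMeasure T) ∧ ∀ᵐ t ∂(timeMeasure T), fnR (w t) = fn (v t)

/-- `v' = ∂_t v` in the weak sense on `I = (0, T)` and `v` is the representative that is
continuous on `[0, T]`: for integrable `v'` this means that `v` is a primitive of `v'`. -/
def IsTimeDeriv {n : ℕ} {Ω : Set (E n)} (T : ℝ) (v v' : ℝ → H2 Ω) : Prop :=
  ∀ t ∈ Icc 0 T, fn (v t) = fn (v 0) + ∫ s in (0 : ℝ)..t, fn (v' s)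

/-! ### The Rosenau–Burgers problem and its discretization -/

/-- The nonlinearity `g : ℝ → ℝⁿ`, `g_i(s) = -(s + s²/2)`. -/
def g (n : ℕ) (s : ℝ) : E n := WithLp.toLp 2 (fun _ => -(s + s ^ 2 / 2))

/-- `u` (with time derivative `ut`) is a weak solution on `[0, T]` with initial value `u0`:
`u ∈ L^∞(I; H²₀(Ω))`, `u_t ∈ L²(I; H²(Ω))`, `u(0) = u₀`, and for almost every `t`, for all
`χ ∈ H²₀(Ω)`,
`(u_t, χ) + (Δ u_t, Δ χ) + α (∇ u, ∇ χ) = (∇ · g(u), χ)`. -/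
structure IsWeakSolution {n : ℕ} {Ω : Set (E n)} (α T : ℝ) (u ut : ℝ → H2 Ω) (u0 : H2 Ω) :
    Prop where
  mem_H20 : ∀ᵐ t ∂(timeMeasure T), u t ∈ H20 Ω
  memLp_u : MemLp u ⊤ (timeMeasure T)
  memLp_ut : MemLp ut 2 (timeMeasure T)
  deriv : IsTimeDeriv T u ut
  init : u 0 = u0
  eqn : ∀ᵐ t ∂(timeMeasure T), ∃ w : L2 Ω, IsWeakDiv Ω (fun x => g n (fn (u t) x)) w ∧
    ∀ χ ∈ H20 Ω,
      ⟪fn (ut t), fn χ⟫ + ⟪lap (ut t), lap χ⟫ + α * ∑ i, ⟪grad (u t) i, grad χ i⟫ = ⟪w, fn χ⟫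

/-- The regularity assumptions: `u ∈ L²(I; H^r)`, `u₀ ∈ H²₀ ∩ H^r`, `u_t ∈ L¹(I; H^r)`,
`u_tt ∈ L¹(I; H²)`. -/
structure IsRegular {n : ℕ} {Ω : Set (E n)} (T : ℝ) (r : ℕ) (u ut utt : ℝ → H2 Ω) (u0 : H2 Ω) :
    Prop where
  u_mem : MemLpHr T 2 r u
  u0_mem_H20 : u0 ∈ H20 Ω
  u0_mem_Hr : ∃ w : Hr r Ω, fnR w = fn u0
  ut_mem : MemLpHr T 1 r ut
  utt_mem : MemLp utt 1 (timeMeasure T)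
  utt_deriv : IsTimeDeriv T ut utt

/-- `S` is a finite-dimensional subspace of `H²₀(Ω)` with mesh parameter `h ∈ (0, 1)` and order of
accuracy `r`, with constant `K`:
`inf_{φ ∈ S} ‖v - φ‖_2 ≤ K h^{r-2} ‖v‖_r` for all `v ∈ H²₀(Ω) ∩ H^r(Ω)`. -/
structure IsApproxSpace {n : ℕ} {Ω : Set (E n)} (K : ℝ) (r : ℕ) (h : ℝ) (S : Submodule ℝ (H2 Ω)) :
    Prop where
  h_pos : 0 < h
  h_lt_one : h < 1
  finite : FiniteDimensional ℝ S
  le_H20 : S ≤ H20 Ω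
  approx : ∀ v ∈ H20 Ω, ∀ w : Hr r Ω, fnR w = fn v →
    ⨅ φ : S, ‖v - (φ : H2 Ω)‖ ≤ K * h ^ (r - 2) * ‖w‖

/-- `p = Π_h v`, the projection of `v` onto `S` that is orthogonal for `A(v, χ) = (Δ v, Δ χ)`. -/
def IsProj {n : ℕ} {Ω : Set (E n)} (S : Submodule ℝ (H2 Ω)) (v p : H2 Ω) : Prop :=
  p ∈ S ∧ ∀ χ ∈ S, ⟪lap (v - p), lap χ⟫ = 0

/-- The backward difference quotient `δ_t U^m = (U^m - U^{m-1}) / k`. -/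
def deltaT {n : ℕ} {Ω : Set (E n)} (k : ℝ) (U : ℕ → H2 Ω) (m : ℕ) : H2 Ω :=
  k⁻¹ • (U m - U (m - 1))

/-- `U^0, …, U^N` in `S` solve the backward Euler scheme with step `k`: `U^0 = Π_h u_0` and, for
`1 ≤ m ≤ N` and all `χ ∈ S`,
`(δ_t U^m, χ) + (Δ δ_t U^m, Δ χ) + α (∇ U^m, ∇ χ) = -(g(U^m), ∇ χ)`. -/
structure IsBackwardEuler {n : ℕ} {Ω : Set (E n)} (α k : ℝ) (N : ℕ) (S : Submodule ℝ (H2 Ω))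
    (u0 : H2 Ω) (U : ℕ → H2 Ω) : Prop where
  mem : ∀ m ≤ N, U m ∈ S
  init : IsProj S u0 (U 0)
  step : ∀ m, 1 ≤ m → m ≤ N → ∀ χ ∈ S,
    ⟪fn (deltaT k U m), fn χ⟫ + ⟪lap (deltaT k U m), lap χ⟫
        + α * ∑ i, ⟪grad (U m) i, grad χ i⟫
      = -∫ x in Ω, ∑ i, g n (fn (U m) x) i * grad χ i x

/-- The discrete norm of `L²(I; H²₀(Ω))`: `(∑_{m=0}^N ‖f^m‖_2²)^{1/2}`. -/
def discL2 {n : ℕ} {Ω : Set (E n)} (N : ℕ) (f : ℕ → H2 Ω) : ℝ :=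
  Real.sqrt (∑ m ∈ Finset.range (N + 1), ‖f m‖ ^ 2)

/-- The discrete norm of `L^∞(I; H²₀(Ω))`: `max_{0 ≤ m ≤ N} ‖f^m‖_2`. -/
def discLinf {n : ℕ} {Ω : Set (E n)} (N : ℕ) (f : ℕ → H2 Ω) : ℝ :=
  (Finset.range (N + 1)).sup' Finset.nonempty_range_add_one (fun m => ‖f m‖)

end

end RosenauBurgers

/-! ### Function spaces and the nonlinearity in the energy norm. -/

namespace RosenauBurgers

noncomputable section

variable {n : ℕ} {Ω : Set (E n)}

/-! ### Pairings with test functions -/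

/-! Everything is measured in the energy norm `‖v‖_E² = ‖v‖² + ‖Δv‖²`, which is equivalent to
`‖v‖_2` on `H²₀(Ω)` because `‖∇v‖² = -(v, Δv)` there. The equation and the scheme then read `(u_t,
χ)_E + b(u, χ) = 0`, on `H²₀(Ω)` and, discretized in time, on `S_h`, with `b(v, χ) = α(∇v, ∇χ) +
(g(v), ∇χ)`. For `n ≤ 2` the embedding into `L⁴(Ω)` makes `b` locally Lipschitz in the energy norm
(`exists_abs_spatialForm_sub_le`), and `∫ (v + v²/2) ∂_i v = 0` gives `b(v, v) ≥ 0`. So the problem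
behaves like an ODE: the energy norms of `u` and `U` do not increase, and `‖u_t‖_E ≤ L ‖u‖_E` in
integrated form, with `L` depending on `R`.

Let `P` be the `E`-orthogonal projection onto `S_h`, `ρ_m = ‖u(t^m) - P u(t^m)‖_E` and `M =
‖u(0)‖_E`. The error is split as `(u - Pu) + (Pu - U)`. Testing the difference of the equations with
`Pu - U` gives a discrete Gronwall recursion (`norm_error_step`, `norm_error_le`), so the error at
level `m` is at most `ρ_m + C (ρ_0 + k ∑ ρ_j + k M)`. The projection `Π_h` enters only through
`U^0`, where it is quasi-optimal. With `ρ_m ≤ K h^{r-2} ‖u(t^m)‖_r` and `‖u(t)‖_r` bounded on `[0,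
T]`, the maximum estimate follows.

The sum of squares carries no weight `k`, so the terms independent of `m` are multiplied by `√N` and
must be charged to `∑_{m ≥ 1} ‖u(t^m)‖_r`, which omits the initial level. Two devices do this. The
bound on `u_t` also works backwards in time: the energy norm loses at most a fixed factor on `[0,
T]` (`IsFlow.norm_zero_le`), so `M ≤ G ‖u(t^m)‖_r` for every `m` and `N k M ≤ G k ∑ ‖u(t^m)‖_r`. And
`ρ_0 ≤ ρ_m + m k L M`, averaged over about `√N` levels, bounds `√N ρ_0` by `∑ ρ_m + 4 N k L M`
(`sqrt_mul_le_of_le_add`). -/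

theorem memLp_cc {ψ : E n → ℝ} (hc : Continuous ψ) (hs : HasCompactSupport ψ) (p : ENNReal) :
    MemLp ψ p (volume.restrict Ω) := hc.memLp_of_hasCompactSupport hs

theorem integral_mul_eq_inner (v : L2 Ω) {ψ : E n → ℝ} (h : MemLp ψ 2 (volume.restrict Ω)) :
    ∫ x in Ω, v x * ψ x = ⟪h.toLp ψ, v⟫ := by
  rw [L2.inner_def]
  refine integral_congr_ae ?_
  filter_upwards [h.coeFn_toLp] with x hx
  simp [hx]

theorem L2.inner_eq_integral (v w : L2 Ω) : ⟪v, w⟫ = ∫ x in Ω, v x * w x := by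
  rw [MeasureTheory.L2.inner_def]
  refine integral_congr_ae (Eventually.of_forall fun x => ?_)
  simp [mul_comm]

theorem continuous_integral_mul {ψ : E n → ℝ} (hc : Continuous ψ) (hs : HasCompactSupport ψ) :
    Continuous fun v : L2 Ω => ∫ x in Ω, v x * ψ x := by
  simp_rw [fun v : L2 Ω => integral_mul_eq_inner v (memLp_cc hc hs 2)]
  fun_prop

/-- An `L²` function is determined by its integrals against test functions. -/
theorem L2.ext_of_isTest (hΩ : IsOpen Ω) {v w : L2 Ω}
    (h : ∀ φ, IsTest Ω φ → ∫ x in Ω, v x * φ x = ∫ x in Ω, w x * φ x) : v = w := by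
  rw [← sub_eq_zero]
  have hloc : LocallyIntegrable (v - w : L2 Ω) (volume.restrict Ω) :=
    (Lp.memLp (v - w)).locallyIntegrable (by norm_num)
  have key := hΩ.ae_eq_zero_of_integral_contDiff_smul_eq_zero (μ := volume.restrict Ω)
    (f := (v - w : L2 Ω)) (hloc.locallyIntegrableOn Ω) (fun φ h1 h2 h3 => by
      have e1 : ∫ x in Ω, φ x • (v - w : L2 Ω) x
          = ∫ x in Ω, (v x * φ x - w x * φ x) := by
        refine integral_congr_ae ?_
        filter_upwards [Lp.coeFn_sub v w] with x hx
        rw [hx, Pi.sub_apply, smul_eq_mul]; ring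
      rw [e1, integral_sub (integrable_mul_cc v h1.continuous h2)
        (integrable_mul_cc w h1.continuous h2), h φ ⟨h1, h2, h3⟩, sub_self])
  rw [Lp.eq_zero_iff_ae_eq_zero]
  filter_upwards [key, ae_restrict_mem hΩ.measurableSet] with x hx hxΩ using hx hxΩ

/-! ### Completeness of the Sobolev spaces -/

/-- Every weak identity compares two `L²`-continuous functionals, so it survives limits.
Completeness is what gives Bochner integrals with values in this space their meaning. -/
theorem isClosed_Hr (r : ℕ) : IsClosed (Hr r Ω : Set (PiLp 2 (fun _ : Idx n r => L2 Ω))) := by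
  have h : (Hr r Ω : Set (PiLp 2 (fun _ : Idx n r => L2 Ω))) =
      ⋂ (a : Idx n r) (φ : E n → ℝ) (_ : IsTest Ω φ),
        {f | ∫ x in Ω, f Idx.zero x * partialD a.2 φ x
          = (-1) ^ (a.1 : ℕ) * ∫ x in Ω, f a x * φ x} := by
    ext f
    simp [Hr, IsWeakD]
  rw [h]
  refine isClosed_iInter fun a => isClosed_iInter fun φ => isClosed_iInter fun hφ => ?_
  refine isClosed_eq ?_ (continuous_const.mul ?_)
  · exact (continuous_integral_mul (partialD_continuous _ hφ) (partialD_compact _ hφ)).comp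
      (by fun_prop)
  · exact (continuous_integral_mul hφ.1.continuous hφ.2.1).comp (by fun_prop)

instance (r : ℕ) : CompleteSpace (Hr r Ω) := (isClosed_Hr r).completeSpace_coe

theorem isClosed_H2 : IsClosed (H2 Ω : Set (PiLp 2 (fun _ : Slot n => L2 Ω))) := by
  have h : (H2 Ω : Set (PiLp 2 (fun _ : Slot n => L2 Ω))) =
      ⋂ (φ : E n → ℝ) (_ : IsTest Ω φ),
        ((⋂ i : Fin n, {f | ∫ x in Ω, f (.inl ()) x * partialD (fun _ : Fin 1 => i) φ x
          = (-1) ^ 1 * ∫ x in Ω, f (.inr (.inl i)) x * φ x}) ∩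
        {f | ∫ x in Ω, f (.inl ()) x * Laplacian.laplacian φ x
          = ∫ x in Ω, f (.inr (.inr ())) x * φ x}) := by
    ext f
    simp only [H2, IsWeakD, IsWeakLaplacian, mem_iInter, mem_inter_iff, mem_ofPred_eq]
    exact ⟨fun h φ hφ => ⟨fun i => h.1 i φ hφ, h.2 φ hφ⟩,
      fun h => ⟨fun i φ hφ => (h φ hφ).1 i, fun φ hφ => (h φ hφ).2⟩⟩
  rw [h]
  refine isClosed_iInter fun φ => isClosed_iInter fun hφ =>
    (isClosed_iInter fun i => ?_).inter ?_
  · refine isClosed_eq ?_ (continuous_const.mul ?_)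
    · exact (continuous_integral_mul (partialD_continuous _ hφ) (partialD_compact _ hφ)).comp
        (by fun_prop)
    · exact (continuous_integral_mul hφ.1.continuous hφ.2.1).comp (by fun_prop)
  · refine isClosed_eq ?_ ?_
    · exact (continuous_integral_mul (laplacian_continuous hφ) (laplacian_compact hφ)).comp
        (by fun_prop)
    · exact (continuous_integral_mul hφ.1.continuous hφ.2.1).comp (by fun_prop)

instance : CompleteSpace (H2 Ω) := isClosed_H2.completeSpace_coe

/-! ### The components of an element of a Sobolev space as continuous linear maps -/

/-- `v ↦ v` as a continuous linear map `H²(Ω) → L²(Ω)`. -/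
def fnL : H2 Ω →L[ℝ] L2 Ω := (PiLp.proj 2 (fun _ : Slot n => L2 Ω) (.inl ())).comp (H2 Ω).subtypeL

/-- `v ↦ ∂_i v` as a continuous linear map `H²(Ω) → L²(Ω)`. -/
def gradL (i : Fin n) : H2 Ω →L[ℝ] L2 Ω :=
  (PiLp.proj 2 (fun _ : Slot n => L2 Ω) (.inr (.inl i))).comp (H2 Ω).subtypeL

/-- `v ↦ Δ v` as a continuous linear map `H²(Ω) → L²(Ω)`. -/
def lapL : H2 Ω →L[ℝ] L2 Ω :=
  (PiLp.proj 2 (fun _ : Slot n => L2 Ω) (.inr (.inr ()))).comp (H2 Ω).subtypeL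

/-- `v ↦ v` as a continuous linear map `H^r(Ω) → L²(Ω)`. -/
def fnRL (r : ℕ) : Hr r Ω →L[ℝ] L2 Ω :=
  (PiLp.proj 2 (fun _ : Idx n r => L2 Ω) Idx.zero).comp (Hr r Ω).subtypeL

theorem fnL_apply (v : H2 Ω) : fnL v = fn v := rfl

theorem continuous_fn : Continuous (fn : H2 Ω → L2 Ω) := fnL.continuous
theorem continuous_grad (i : Fin n) : Continuous fun v : H2 Ω => grad v i := (gradL i).continuous
theorem continuous_lap : Continuous (lap : H2 Ω → L2 Ω) := lapL.continuous

theorem fn_sub (v w : H2 Ω) : fn (v - w) = fn v - fn w := fnL.map_sub v w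
theorem grad_sub (v w : H2 Ω) (i : Fin n) : grad (v - w) i = grad v i - grad w i :=
  (gradL i).map_sub v w
theorem lap_sub (v w : H2 Ω) : lap (v - w) = lap v - lap w := lapL.map_sub v w
theorem fn_zero : fn (0 : H2 Ω) = 0 := fnL.map_zero

theorem isWeakD_grad (v : H2 Ω) (i : Fin n) :
    IsWeakD Ω (fun _ : Fin 1 => i) (fn v) (grad v i) := v.2.1 i

theorem isWeakLaplacian_lap (v : H2 Ω) : IsWeakLaplacian Ω (fn v) (lap v) := v.2.2

/-! ### Uniqueness of weak derivatives -/

theorem IsWeakD.unique (hΩ : IsOpen Ω) {m : ℕ} {σ : Fin m → Fin n} {v : E n → ℝ} {w w' : L2 Ω}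
    (h : IsWeakD Ω σ v w) (h' : IsWeakD Ω σ v w') : w = w' := by
  refine L2.ext_of_isTest hΩ fun φ hφ => ?_
  have := (h φ hφ).symm.trans (h' φ hφ)
  exact mul_left_cancel₀ (pow_ne_zero _ (by norm_num)) this

theorem IsWeakLaplacian.unique (hΩ : IsOpen Ω) {v : E n → ℝ} {w w' : L2 Ω}
    (h : IsWeakLaplacian Ω v w) (h' : IsWeakLaplacian Ω v w') : w = w' :=
  L2.ext_of_isTest hΩ fun φ hφ => (h φ hφ).symm.trans (h' φ hφ)

/-- Allows identities known only for the underlying functions, such as `IsTimeDeriv`, to be lifted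
to `H²(Ω)`. -/
theorem H2.ext_fn (hΩ : IsOpen Ω) {v w : H2 Ω} (h : fn v = fn w) : v = w := by
  have hg : ∀ i, grad v i = grad w i := fun i =>
    (isWeakD_grad v i).unique hΩ (h ▸ isWeakD_grad w i)
  have hl : lap v = lap w := (isWeakLaplacian_lap v).unique hΩ (h ▸ isWeakLaplacian_lap w)
  refine Subtype.ext (PiLp.ext fun s => ?_)
  rcases s with _ | i | _
  · exact h
  · exact hg i
  · exact hl

theorem Hr.ext_fnR (hΩ : IsOpen Ω) {r : ℕ} {v w : Hr r Ω} (h : fnR v = fnR w) : v = w := by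
  refine Subtype.ext (PiLp.ext fun a => ?_)
  have h1 : IsWeakD Ω a.2 (fnR v) (v.1 a) := v.2 a
  have h2 : IsWeakD Ω a.2 (fnR w) (w.1 a) := w.2 a
  rw [← h] at h2
  exact h1.unique hΩ h2

theorem sobNorm_eq (hΩ : IsOpen Ω) {r : ℕ} {v : L2 Ω} {w : Hr r Ω} (h : fnR w = v) :
    sobNorm r v = ‖w‖ := by
  have : {a | ∃ w : Hr r Ω, fnR w = v ∧ a = ‖w‖} = {‖w‖} := by
    ext a
    refine ⟨?_, fun ha => ⟨w, h, ha⟩⟩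
    rintro ⟨w', hw', rfl⟩
    rw [Hr.ext_fnR hΩ (hw'.trans h.symm)]
    rfl
  rw [sobNorm, this, csInf_singleton]

theorem sobNorm_nonneg (r : ℕ) (v : L2 Ω) : 0 ≤ sobNorm r v :=
  Real.sInf_nonneg (by rintro _ ⟨w, -, rfl⟩; exact norm_nonneg _)

/-! ### Comparison of the norms of `H²` and `H^r` -/

theorem norm_comp_le_Hr {r : ℕ} (w : Hr r Ω) (a : Idx n r) : ‖w.1 a‖ ≤ ‖w‖ :=
  PiLp.norm_apply_le w.1 a

/-- By uniqueness, the weak gradient is part of the `H^r` family and the weak Laplacian is the sum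
of its pure second derivatives. The constant is crude. -/
theorem norm_H2_le_Hr (hΩ : IsOpen Ω) {r : ℕ} (hr : 2 ≤ r) {v : H2 Ω} {w : Hr r Ω}
    (h : fnR w = fn v) : ‖v‖ ≤ (1 + 2 * n) * ‖w‖ := by
  have hg : ∀ i, ‖grad v i‖ ≤ ‖w‖ := fun i => by
    let a : Idx n r := ⟨⟨1, by omega⟩, fun _ => i⟩
    have h1 : IsWeakD Ω (fun _ : Fin 1 => i) (fnR w) (w.1 a) := w.2 a
    rw [h] at h1
    rw [(isWeakD_grad v i).unique hΩ h1]
    exact norm_comp_le_Hr w a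
  let a : Fin n → Idx n r := fun i => ⟨⟨2, by omega⟩, fun _ => i⟩
  have hl : lap v = ∑ i, w.1 (a i) := by
    refine (isWeakLaplacian_lap v).unique hΩ fun φ hφ => ?_
    have hφi := fun i => partialD_continuous (fun _ : Fin 2 => i) hφ
    have hφc := fun i => partialD_compact (fun _ : Fin 2 => i) hφ
    have e1 : ∫ x in Ω, (∑ i, w.1 (a i) : L2 Ω) x * φ x = ∑ i, ∫ x in Ω, w.1 (a i) x * φ x := by
      simp_rw [fun v : L2 Ω => integral_mul_eq_inner v (memLp_cc hφ.1.continuous hφ.2.1 2),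
        inner_sum]
    rw [e1, laplacian_eq_partialD]
    simp_rw [Finset.mul_sum]
    rw [integral_finsetSum _ fun i _ => integrable_mul_cc (fn v) (hφi i) (hφc i)]
    refine Finset.sum_congr rfl fun i _ => ?_
    have h1 : IsWeakD Ω (fun _ : Fin 2 => i) (fnR w) (w.1 (a i)) := w.2 (a i)
    rw [h] at h1
    rw [h1 φ hφ]; norm_num
  have hl' : ‖lap v‖ ≤ n * ‖w‖ := by
    rw [hl]
    refine (norm_sum_le _ _).trans ((Finset.sum_le_sum fun i _ => norm_comp_le_Hr w (a i)).trans ?_)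
    simp
  have hf : ‖fn v‖ ≤ ‖w‖ := by rw [← h]; exact norm_comp_le_Hr w _
  have h0 := norm_nonneg w
  have hgs : ∑ i, ‖grad v i‖ ^ 2 ≤ n * ‖w‖ ^ 2 := by
    refine (Finset.sum_le_sum fun i _ => pow_le_pow_left₀ (norm_nonneg _) (hg i) 2).trans ?_
    simp
  refine le_of_sq_le_sq ?_ (by positivity)
  rw [norm_sq_eq]
  have h2 := pow_le_pow_left₀ (norm_nonneg _) hf 2
  have h3 := pow_le_pow_left₀ (norm_nonneg _) hl' 2
  have hn : (0 : ℝ) ≤ n := Nat.cast_nonneg n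
  nlinarith [mul_nonneg hn (sq_nonneg ‖w‖), mul_nonneg (mul_nonneg hn hn) (sq_nonneg ‖w‖)]

/-! ### Test functions in `H²₀(Ω)` -/

theorem IsTest.add {φ ψ : E n → ℝ} (h : IsTest Ω φ) (h' : IsTest Ω ψ) : IsTest Ω (φ + ψ) :=
  ⟨h.1.add h'.1, h.2.1.add h'.2.1,
    (tsupport_add φ ψ).trans (union_subset h.2.2 h'.2.2)⟩

theorem IsTest.mul {φ ψ : E n → ℝ} (h : IsTest Ω φ) (h' : IsTest Ω ψ) : IsTest Ω (φ * ψ) :=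
  ⟨h.1.mul h'.1, h.2.1.mul_right, (tsupport_mul_subset_left).trans h.2.2⟩

theorem IsTest.const_smul {φ : E n → ℝ} (c : ℝ) (h : IsTest Ω φ) : IsTest Ω (c • φ) :=
  ⟨h.1.const_smul c, h.2.1.smul_left (f := fun _ => c),
    (closure_mono (Function.support_const_smul_subset c φ)).trans h.2.2⟩

theorem IsTest.zero : IsTest Ω (0 : E n → ℝ) :=
  ⟨contDiff_const, HasCompactSupport.zero, by simp⟩

theorem IsTest.partialD {φ : E n → ℝ} (h : IsTest Ω φ) (i : Fin n) :
    IsTest Ω (partialD (fun _ : Fin 1 => i) φ) := by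
  refine ⟨?_, partialD_compact _ h, ?_⟩
  · rw [← fderiv_eq_partialD]
    exact (h.1.fderiv_right (m := ∞) (by simp)).clm_apply contDiff_const
  · rw [← fderiv_eq_partialD]
    exact (tsupport_fderiv_apply_subset ℝ (e i)).trans h.2.2

theorem partialD_partialD {φ : E n → ℝ} (h : IsTest Ω φ) (i : Fin n) :
    RosenauBurgers.partialD (fun _ : Fin 1 => i) (RosenauBurgers.partialD (fun _ : Fin 1 => i) φ)
      = RosenauBurgers.partialD (fun _ : Fin 2 => i) φ := by
  rw [← fderiv_eq_partialD, ← fderiv_eq_partialD]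
  funext x
  have hd : DifferentiableAt ℝ (fderiv ℝ φ) x :=
    ((h.1.fderiv_right (m := 1) (by norm_cast)).differentiable one_ne_zero) x
  rw [fderiv_clm_apply hd (differentiableAt_const _)]
  simp [RosenauBurgers.partialD, iteratedFDeriv_two_apply]

theorem IsTest.eq_zero {φ : E n → ℝ} (h : IsTest Ω φ) {x : E n} (hx : x ∉ Ω) : φ x = 0 :=
  image_eq_zero_of_notMem_tsupport fun h' => hx (h.2.2 h')

theorem IsTest.integral_mul_partialD {φ ψ : E n → ℝ} (h : IsTest Ω φ) (h' : IsTest Ω ψ)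
    (i : Fin n) :
    ∫ x in Ω, φ x * RosenauBurgers.partialD (fun _ : Fin 1 => i) ψ x
      = -∫ x in Ω, RosenauBurgers.partialD (fun _ : Fin 1 => i) φ x * ψ x := by
  have hi := h.partialD i
  have hi' := h'.partialD i
  -- Both integrands vanish outside `Ω`, so the integration by parts takes place in the whole space
  -- without boundary terms.
  rw [setIntegral_eq_integral_of_forall_compl_eq_zero fun x hx => by rw [h.eq_zero hx, zero_mul],
    setIntegral_eq_integral_of_forall_compl_eq_zero fun x hx => by rw [h'.eq_zero hx, mul_zero]]
  have hint : ∀ {f g : E n → ℝ}, IsTest Ω f → IsTest Ω g →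
      Integrable (fun x => f x * g x) volume := fun hf hg =>
    (hf.1.continuous.mul hg.1.continuous).integrable_of_hasCompactSupport hf.2.1.mul_right
  have h1 := hint hi h'
  have h2 := hint h hi'
  rw [← fderiv_eq_partialD] at h1 h2 ⊢
  rw [← fderiv_eq_partialD]
  exact integral_mul_fderiv_eq_neg_fderiv_mul_of_integrable h1 h2 (hint h h')
    (fun x _ => h.1.differentiable (by simp) x) (fun x _ => h'.1.differentiable (by simp) x)

/-- The elements of `H²(Ω)` that are represented by test functions. -/
def testSubmodule (Ω : Set (E n)) : Submodule ℝ (H2 Ω) where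
  carrier := {f : H2 Ω | ∃ φ, IsTest Ω φ ∧ (fn f : E n → ℝ) =ᵐ[volume.restrict Ω] φ}
  add_mem' := by
    rintro f f' ⟨φ, hφ, h⟩ ⟨φ', hφ', h'⟩
    exact ⟨φ + φ', hφ.add hφ', (Lp.coeFn_add (fn f) (fn f')).trans (h.add h')⟩
  zero_mem' := ⟨0, IsTest.zero, Lp.coeFn_zero _ _ _⟩
  smul_mem' := by
    rintro c f ⟨φ, hφ, h⟩
    exact ⟨c • φ, hφ.const_smul c, (Lp.coeFn_smul c (fn f)).trans (h.const_smul c)⟩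

theorem H20_eq : H20 Ω = (testSubmodule Ω).topologicalClosure := by
  rw [H20]
  congr 1
  exact Submodule.span_eq (testSubmodule Ω)

theorem isClosed_H20 : IsClosed (H20 Ω : Set (H2 Ω)) := Submodule.isClosed_topologicalClosure _

theorem testSubmodule_le_H20 : testSubmodule Ω ≤ H20 Ω := by
  rw [H20_eq]
  exact Submodule.le_topologicalClosure _

theorem exists_seq_testSubmodule {v : H2 Ω} (hv : v ∈ H20 Ω) :
    ∃ f : ℕ → H2 Ω, (∀ k, f k ∈ testSubmodule Ω) ∧ Tendsto f atTop (𝓝 v) := by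
  rw [H20_eq, ← SetLike.mem_coe, Submodule.topologicalClosure_coe, mem_closure_iff_seq_limit] at hv
  exact hv

theorem H20_induction {P : H2 Ω → Prop} (hP : IsClosed {v | P v})
    (h : ∀ v ∈ testSubmodule Ω, P v) {v : H2 Ω} (hv : v ∈ H20 Ω) : P v := by
  obtain ⟨f, hf, hfv⟩ := exists_seq_testSubmodule hv
  exact hP.mem_of_tendsto hfv (Eventually.of_forall fun k => h _ (hf k))

theorem grad_ae_eq (hΩ : IsOpen Ω) {f : H2 Ω} {φ : E n → ℝ} (hφ : IsTest Ω φ)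
    (h : (fn f : E n → ℝ) =ᵐ[volume.restrict Ω] φ) (i : Fin n) :
    (grad f i : E n → ℝ) =ᵐ[volume.restrict Ω] partialD (fun _ : Fin 1 => i) φ := by
  have hm : MemLp (partialD (fun _ : Fin 1 => i) φ) 2 (volume.restrict Ω) :=
    memLp_cc (partialD_continuous _ hφ) (partialD_compact _ hφ) 2
  have key : grad f i = hm.toLp _ := by
    refine L2.ext_of_isTest hΩ fun ψ hψ => ?_
    have h1 := isWeakD_grad f i ψ hψ
    have h2 : ∫ x in Ω, fn f x * partialD (fun _ : Fin 1 => i) ψ x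
        = ∫ x in Ω, φ x * partialD (fun _ : Fin 1 => i) ψ x := by
      refine integral_congr_ae ?_
      filter_upwards [h] with x hx
      rw [hx]
    have h3 : ∫ x in Ω, hm.toLp _ x * ψ x = ∫ x in Ω, partialD (fun _ : Fin 1 => i) φ x * ψ x := by
      refine integral_congr_ae ?_
      filter_upwards [hm.coeFn_toLp] with x hx
      rw [hx]
    rw [h2, hφ.integral_mul_partialD hψ i] at h1
    rw [h3]
    linarith
  rw [key]
  exact hm.coeFn_toLp

theorem integral_mul_congr_right (v : L2 Ω) {w : L2 Ω} {ψ : E n → ℝ}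
    (h : (w : E n → ℝ) =ᵐ[volume.restrict Ω] ψ) : ∫ x in Ω, v x * ψ x = ⟪v, w⟫ := by
  rw [L2.inner_eq_integral]
  refine integral_congr_ae ?_
  filter_upwards [h] with x hx
  rw [hx]

/-- `‖∇v‖² = -(v, Δv)` for `v ∈ H²₀(Ω)`. -/
theorem sum_norm_grad_sq (hΩ : IsOpen Ω) {v : H2 Ω} (hv : v ∈ H20 Ω) :
    ∑ i, ‖grad v i‖ ^ 2 = -⟪fn v, lap v⟫ := by
  refine H20_induction (P := fun v => ∑ i, ‖grad v i‖ ^ 2 = -⟪fn v, lap v⟫) ?_ ?_ hv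
  · refine isClosed_eq (continuous_finsetSum _ fun i _ => ((continuous_grad i).norm.pow 2)) ?_
    exact (continuous_fn.inner continuous_lap).neg
  · rintro f ⟨φ, hφ, h⟩
    have hL := isWeakLaplacian_lap f φ hφ
    rw [laplacian_eq_partialD] at hL
    simp_rw [Finset.mul_sum] at hL
    rw [integral_finsetSum _ fun i _ => integrable_mul_cc (fn f) (partialD_continuous _ hφ)
      (partialD_compact _ hφ), integral_mul_congr_right _ h, real_inner_comm] at hL
    rw [← hL, ← Finset.sum_neg_distrib]
    refine Finset.sum_congr rfl fun i _ => ?_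
    have h1 := isWeakD_grad f i _ (hφ.partialD i)
    rw [partialD_partialD hφ, integral_mul_congr_right _ (grad_ae_eq hΩ hφ h i)] at h1
    rw [h1, real_inner_self_eq_norm_sq]; ring

/-! ### The embedding of `H²₀(Ω)` into `L⁴(Ω)` -/

/-- The fundamental theorem of calculus from `-∞`, after identifying the line with `E 1` by the
measure-preserving isometry `γ`. -/
theorem IsTest.enorm_le_eLpNorm_fderiv_one {Ω : Set (E 1)} {φ : E 1 → ℝ} (h : IsTest Ω φ)
    (x : E 1) : ‖φ x‖ₑ ≤ eLpNorm (fderiv ℝ φ) 1 volume := by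
  let γ : ℝ → E 1 := fun t => WithLp.toLp 2 fun _ => t
  have hγ : MeasurePreserving γ volume volume :=
    (EuclideanSpace.volume_preserving_symm_measurableEquiv_toLp (Fin 1)).symm.comp
      ((volume_preserving_funUnique (Fin 1) ℝ).symm _)
  have hγe : ∀ t, γ t = t • e 0 := fun t => by
    ext i; fin_cases i; simp [γ, e]
  have hγx : γ (x 0) = x := by ext i; fin_cases i; rfl
  have hγc : ContDiff ℝ ∞ γ := by
    rw [funext hγe]; fun_prop
  have hγi : Topology.IsClosedEmbedding γ := by
    refine Isometry.isClosedEmbedding (Isometry.of_dist_eq fun s t => ?_)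
    rw [hγe, hγe, dist_eq_norm, ← sub_smul, norm_smul]
    simp [e, Real.dist_eq]
  have h1 : ContDiff ℝ 1 (φ ∘ γ) := (h.1.comp hγc).of_le (by norm_cast)
  have h2 : HasCompactSupport (φ ∘ γ) := h.2.1.comp_isClosedEmbedding hγi
  calc ‖φ x‖ₑ = ‖(φ ∘ γ) (x 0)‖ₑ := by rw [Function.comp, hγx]
    _ ≤ ∫⁻ t in Iic (x 0), ‖deriv (φ ∘ γ) t‖ₑ := h2.enorm_le_lintegral_Ici_deriv h1 _
    _ ≤ ∫⁻ t, ‖deriv (φ ∘ γ) t‖ₑ := setLIntegral_le_lintegral _ _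
    _ ≤ ∫⁻ t, ‖fderiv ℝ φ (γ t)‖ₑ := by
        refine lintegral_mono fun t => ?_
        have hd : HasDerivAt γ (e 0) t := by
          rw [funext hγe]
          simpa using (hasDerivAt_id t).smul_const (e 0 : E 1)
        have := ((h.1.differentiable (by simp) (γ t)).hasFDerivAt.comp_hasDerivAt t hd).deriv
        rw [this]
        refine (ContinuousLinearMap.le_opENorm _ _).trans ?_
        have : ‖(e 0 : E 1)‖ₑ = 1 := by
          rw [← ofReal_norm]; simp [e]
        rw [this, mul_one]
    _ = eLpNorm (fderiv ℝ φ) 1 volume := by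
        rw [eLpNorm_one_eq_lintegral_enorm]
        exact hγ.lintegral_comp
          ((h.1.continuous_fderiv (by simp)).enorm.measurable)

theorem IsTest.eLpNorm_fderiv_restrict {φ : E n → ℝ} (h : IsTest Ω φ) (p : ENNReal) :
    eLpNorm (fderiv ℝ φ) p (volume.restrict Ω) = eLpNorm (fderiv ℝ φ) p volume := by
  have hs : Function.support (fderiv ℝ φ) ⊆ Ω := (support_fderiv_subset ℝ).trans h.2.2
  generalize fderiv ℝ φ = f at *
  exact eLpNorm_restrict_eq_of_support_subset (ε := E n →L[ℝ] ℝ) (μ := volume) hs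

theorem IsTest.eLpNorm_fderiv_le {φ : E n → ℝ} (h : IsTest Ω φ) {p : ENNReal} (hp : p ≤ 2) :
    eLpNorm (fderiv ℝ φ) p volume ≤ eLpNorm (fderiv ℝ φ) 2 (volume.restrict Ω)
      * volume Ω ^ (1 / p.toReal - 1 / 2) := by
  rw [← h.eLpNorm_fderiv_restrict]
  have := eLpNorm_le_eLpNorm_mul_rpow_measure_univ (μ := volume.restrict Ω) hp
    (h.1.continuous_fderiv (by simp)).aestronglyMeasurable
  simpa using this

/-- The place where the dimension matters. For `n = 1` the sup bound and the finite measure of `Ω`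
suffice. For `n = 2` the Sobolev inequality is used with the exponent `4/3`, since `3/4 - 1/2 =
1/4`, and Hölder on `Ω` passes from `4/3` to `2`. -/
theorem exists_eLpNorm_four_le (hn : 1 ≤ n) (hn2 : n ≤ 2) (hΩb : Bornology.IsBounded Ω) :
    ∃ C : ENNReal, C ≠ ⊤ ∧ ∀ φ, IsTest Ω φ →
      eLpNorm φ 4 (volume.restrict Ω) ≤ C * eLpNorm (fderiv ℝ φ) 2 (volume.restrict Ω) := by
  have hvol : volume Ω ≠ ⊤ := hΩb.measure_lt_top.ne
  obtain rfl | rfl : n = 1 ∨ n = 2 := by omega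
  · refine ⟨volume Ω ^ (1 / 4 : ℝ) * volume Ω ^ (1 / 2 : ℝ), ENNReal.mul_ne_top
      (ENNReal.rpow_ne_top_of_nonneg (by norm_num) hvol)
      (ENNReal.rpow_ne_top_of_nonneg (by norm_num) hvol), fun φ hφ => ?_⟩
    have h1 := hφ.eLpNorm_fderiv_le (p := 1) (by norm_num)
    have hsup : eLpNorm φ ⊤ (volume.restrict Ω) ≤ eLpNorm (fderiv ℝ φ) 1 volume := by
      rw [eLpNorm_exponent_top]
      exact essSup_le_of_ae_le _ (Eventually.of_forall hφ.enorm_le_eLpNorm_fderiv_one)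
    have h4 := eLpNorm_le_eLpNorm_mul_rpow_measure_univ (μ := volume.restrict Ω)
      (p := 4) (q := ⊤) le_top hφ.1.continuous.aestronglyMeasurable
    refine h4.trans ((mul_le_mul_left (hsup.trans h1) _).trans (le_of_eq ?_))
    norm_num
    ring
  · refine ⟨eLpNormLESNormFDerivOfLeConst ℝ (volume : Measure (E 2)) Ω (4 / 3 : NNReal) 4
      * volume Ω ^ (1 / (4 / 3) - 1 / 2 : ℝ), ENNReal.mul_ne_top ENNReal.coe_ne_top
      (ENNReal.rpow_ne_top_of_nonneg (by norm_num) hvol), fun φ hφ => ?_⟩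
    have h1 := hφ.eLpNorm_fderiv_le (p := ((4 / 3 : NNReal) : ENNReal)) (by
      rw [← ENNReal.coe_ofNat, ENNReal.coe_le_coe, div_le_iff₀ (by norm_num)]; norm_num)
    have h2 := eLpNorm_le_eLpNorm_fderiv_of_le (volume : Measure (E 2)) (F := ℝ) (u := φ) (s := Ω)
      (p := 4 / 3) (q := 4) (hφ.1.of_le (by norm_cast)) ((subset_tsupport φ).trans hφ.2.2)
      (by rw [le_div_iff₀ (by norm_num)]; norm_num)
      (by
        rw [finrank_euclideanSpace_fin, div_lt_iff₀ (by norm_num)]; norm_num)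
      (by rw [finrank_euclideanSpace_fin]; norm_num) hΩb
    rw [eLpNorm_restrict_eq_of_support_subset ((subset_tsupport φ).trans hφ.2.2)]
    refine (h2.trans (mul_le_mul_right h1 _)).trans (le_of_eq ?_)
    simp only [ENNReal.coe_toReal, NNReal.coe_div, NNReal.coe_ofNat]
    ring

theorem eLpNorm_fderiv_le_sum (hΩ : IsOpen Ω) {f : H2 Ω} {φ : E n → ℝ} (hφ : IsTest Ω φ)
    (h : (fn f : E n → ℝ) =ᵐ[volume.restrict Ω] φ) :
    eLpNorm (fderiv ℝ φ) 2 (volume.restrict Ω) ≤ ∑ i, ‖grad f i‖ₑ := by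
  have hc : ∀ i : Fin n, Continuous (partialD (fun _ : Fin 1 => i) φ) :=
    fun i => partialD_continuous _ hφ
  have h1 : eLpNorm (fderiv ℝ φ) 2 (volume.restrict Ω) ≤
      eLpNorm (∑ i, fun x => ‖partialD (fun _ : Fin 1 => i) φ x‖) 2 (volume.restrict Ω) := by
    refine eLpNorm_mono_real fun x => ?_
    refine ContinuousLinearMap.opNorm_le_bound _ (by
      rw [Finset.sum_apply]; exact Finset.sum_nonneg fun i _ => norm_nonneg _) fun y => ?_
    have hy : y = ∑ i, y i • (e i : E n) := by
      simpa [e] using ((EuclideanSpace.basisFun (Fin n) ℝ).sum_repr y).symm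
    conv_lhs => rw [hy, map_sum]
    rw [Finset.sum_apply, Finset.sum_mul]
    refine (norm_sum_le _ _).trans (Finset.sum_le_sum fun i _ => ?_)
    rw [map_smul, norm_smul, mul_comm, congrFun (fderiv_eq_partialD i φ) x]
    exact mul_le_mul_of_nonneg_left (PiLp.norm_apply_le y i) (norm_nonneg _)
  refine h1.trans ((eLpNorm_sum_le (fun i _ => (hc i).norm.aestronglyMeasurable)
    (by norm_num)).trans (Finset.sum_le_sum fun i _ => le_of_eq ?_))
  rw [eLpNorm_norm, Lp.enorm_def]
  exact (eLpNorm_congr_ae (grad_ae_eq hΩ hφ h i)).symm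

/-- The embedding of `H²₀(Ω)` into `L⁴(Ω)`. -/
theorem exists_L4_bound (hn : 1 ≤ n) (hn2 : n ≤ 2) (hΩ : IsOpen Ω)
    (hΩb : Bornology.IsBounded Ω) :
    ∃ C : ℝ, 0 ≤ C ∧ ∀ v ∈ H20 Ω,
      MemLp (fn v) 4 (volume.restrict Ω) ∧
      (eLpNorm (fn v) 4 (volume.restrict Ω)).toReal ≤ C * ∑ i, ‖grad v i‖ := by
  obtain ⟨C, hC, h⟩ := exists_eLpNorm_four_le hn hn2 hΩb
  refine ⟨C.toReal, ENNReal.toReal_nonneg, fun v hv => ?_⟩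
  obtain ⟨f, hf, hfv⟩ := exists_seq_testSubmodule hv
  have hle : eLpNorm (fn v) 4 (volume.restrict Ω) ≤ C * ∑ i, ‖grad v i‖ₑ := by
    refine le_of_forall_gt_imp_ge_of_dense fun D hD => ?_
    have hlim : Tendsto (fun k => C * ∑ i, ‖grad (f k) i‖ₑ) atTop
        (𝓝 (C * ∑ i, ‖grad v i‖ₑ)) := by
      refine ENNReal.Tendsto.const_mul (tendsto_finsetSum _ fun i _ => ?_) (Or.inr hC)
      exact ((continuous_grad i).enorm.tendsto v).comp hfv
    -- Lower semicontinuity of the `L⁴` norm: convergence in `L²` implies convergence in measure,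
    -- and the approximating test functions eventually have `L⁴` norm at most `D`.
    refine eLpNorm_le_of_tendstoInMeasure (f := fun k => (fn (f k) : E n → ℝ)) (u := atTop) ?_
      (tendstoInMeasure_of_tendsto_Lp ((continuous_fn.tendsto v).comp hfv))
      (fun k => Lp.aestronglyMeasurable _)
    filter_upwards [hlim.eventually_le_const hD] with k hk
    obtain ⟨φ, hφ, hk'⟩ := hf k
    rw [eLpNorm_congr_ae hk']
    exact (h φ hφ).trans ((mul_le_mul_right (eLpNorm_fderiv_le_sum hΩ hφ hk') _).trans hk)
  have hfin : C * ∑ i, ‖grad v i‖ₑ ≠ ⊤ :=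
    ENNReal.mul_ne_top hC (ENNReal.sum_ne_top.2 fun i _ => enorm_ne_top)
  refine ⟨⟨Lp.aestronglyMeasurable _, hle.trans_lt hfin.lt_top⟩, ?_⟩
  refine (ENNReal.toReal_mono hfin hle).trans (le_of_eq ?_)
  rw [ENNReal.toReal_mul, ENNReal.toReal_sum fun i _ => enorm_ne_top]
  simp

/-! ### The energy inner product `(v, w) + (Δv, Δw)` -/

/-- The map `v ↦ (v, Δv)`, whose pulled back inner product is `(v, w) + (Δv, Δw)`. -/
def energyMap : H2 Ω →L[ℝ] WithLp 2 (L2 Ω × L2 Ω) :=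
  ((WithLp.prodContinuousLinearEquiv 2 ℝ (L2 Ω) (L2 Ω)).symm : _ →L[ℝ] _).comp (fnL.prod lapL)

theorem inner_energyMap (v w : H2 Ω) :
    ⟪energyMap v, energyMap w⟫ = ⟪fn v, fn w⟫ + ⟪lap v, lap w⟫ := rfl

theorem norm_energyMap_sq (v : H2 Ω) : ‖energyMap v‖ ^ 2 = ‖fn v‖ ^ 2 + ‖lap v‖ ^ 2 := by
  rw [← real_inner_self_eq_norm_sq, inner_energyMap, real_inner_self_eq_norm_sq,
    real_inner_self_eq_norm_sq]

theorem norm_grad_le (v : H2 Ω) (i : Fin n) : ‖grad v i‖ ≤ ‖v‖ := PiLp.norm_apply_le v.1 _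

theorem norm_energyMap_le (v : H2 Ω) : ‖energyMap v‖ ≤ ‖v‖ := by
  refine le_of_sq_le_sq ?_ (norm_nonneg _)
  rw [norm_energyMap_sq, norm_sq_eq]
  have : 0 ≤ ∑ i, ‖grad v i‖ ^ 2 := Finset.sum_nonneg fun i _ => sq_nonneg _
  linarith

/-- By `sum_norm_grad_sq` and Cauchy–Schwarz, `‖∇v‖² ≤ ‖v‖ ‖Δv‖`, so the gradient costs nothing
beyond the energy norm. -/
theorem norm_le_energyMap (hΩ : IsOpen Ω) {v : H2 Ω} (hv : v ∈ H20 Ω) :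
    ‖v‖ ≤ 2 * ‖energyMap v‖ := by
  refine le_of_sq_le_sq ?_ (by positivity)
  rw [mul_pow, norm_energyMap_sq, norm_sq_eq, sum_norm_grad_sq hΩ hv]
  have h := (neg_le_abs _).trans (abs_real_inner_le_norm (fn v) (lap v))
  nlinarith [sq_nonneg (‖fn v‖ - ‖lap v‖), sq_nonneg ‖fn v‖, sq_nonneg ‖lap v‖]

theorem eLpNorm_two_le_four (hΩb : Bornology.IsBounded Ω) {v : L2 Ω}
    (h : MemLp v 4 (volume.restrict Ω)) :
    ‖v‖ ≤ (volume Ω ^ (1 / 4 : ℝ)).toReal * (eLpNorm v 4 (volume.restrict Ω)).toReal := by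
  have hvol : volume Ω ≠ ⊤ := hΩb.measure_lt_top.ne
  have h1 := eLpNorm_le_eLpNorm_mul_rpow_measure_univ (μ := volume.restrict Ω) (p := 2) (q := 4)
    (by norm_num) h.1
  rw [Lp.norm_def, ← ENNReal.toReal_mul]
  refine ENNReal.toReal_mono (ENNReal.mul_ne_top
    (ENNReal.rpow_ne_top_of_nonneg (by norm_num) hvol) h.2.ne) (h1.trans (le_of_eq ?_))
  rw [Measure.restrict_apply_univ, mul_comm]
  norm_num

/-- On `H²₀(Ω)` the Laplacian controls the function. -/
theorem exists_norm_fn_le_lap (hn : 1 ≤ n) (hn2 : n ≤ 2) (hΩ : IsOpen Ω)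
    (hΩb : Bornology.IsBounded Ω) :
    ∃ C : ℝ, 0 ≤ C ∧ ∀ v ∈ H20 Ω, ‖fn v‖ ≤ C * ‖lap v‖ := by
  obtain ⟨C, hC, h⟩ := exists_L4_bound hn hn2 hΩ hΩb
  set D : ℝ := (volume Ω ^ (1 / 4 : ℝ)).toReal * C with hD
  have hD0 : 0 ≤ D := by positivity
  refine ⟨D ^ 2 * n, by positivity, fun v hv => ?_⟩
  -- A Poincaré inequality obtained through `L⁴`. Squared and combined with `‖∇v‖² ≤ ‖v‖ ‖Δv‖`, it
  -- leaves one factor `‖v‖` to cancel.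
  have h1 : ‖fn v‖ ≤ D * ∑ i, ‖grad v i‖ := by
    refine (eLpNorm_two_le_four hΩb (h v hv).1).trans ?_
    rw [hD, mul_assoc]
    exact mul_le_mul_of_nonneg_left (h v hv).2 ENNReal.toReal_nonneg
  have h2 : (∑ i, ‖grad v i‖) ^ 2 ≤ n * ∑ i, ‖grad v i‖ ^ 2 := by
    simpa using sq_sum_le_card_mul_sum_sq (s := Finset.univ) (f := fun i => ‖grad v i‖)
  have h3 : ∑ i, ‖grad v i‖ ^ 2 ≤ ‖fn v‖ * ‖lap v‖ := by
    rw [sum_norm_grad_sq hΩ hv]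
    exact (neg_le_abs _).trans (abs_real_inner_le_norm _ _)
  have h4 : ‖fn v‖ ^ 2 ≤ D ^ 2 * (n * (‖fn v‖ * ‖lap v‖)) := by
    refine (pow_le_pow_left₀ (norm_nonneg _) h1 2).trans ?_
    rw [mul_pow]
    refine mul_le_mul_of_nonneg_left (h2.trans ?_) (sq_nonneg _)
    exact mul_le_mul_of_nonneg_left h3 (Nat.cast_nonneg n)
  rcases (norm_nonneg (fn v)).eq_or_lt with h0 | h0
  · rw [← h0]; positivity
  · refine le_of_mul_le_mul_left ?_ h0
    nlinarith

/-! ### The nonlinearity -/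

/-- The function `v + v² / 2` as an element of `L²(Ω)`, for `v ∈ L⁴(Ω)`. -/
def quad (v : L2 Ω) : L2 Ω :=
  open scoped Classical in
  if h : MemLp (fun x => v x + v x ^ 2 / 2) 2 (volume.restrict Ω) then h.toLp _ else 0

theorem holderTriple_four : ENNReal.HolderTriple 4 4 2 :=
  .of_toReal ⟨by norm_num, by norm_num, by norm_num⟩

theorem memLp_quad {v : L2 Ω} (h : MemLp v 4 (volume.restrict Ω)) :
    MemLp (fun x => v x + v x ^ 2 / 2) 2 (volume.restrict Ω) := by
  have := holderTriple_four
  have h2 : MemLp (fun x => v x * v x) 2 (volume.restrict Ω) := h.mul' h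
  refine (Lp.memLp v).add ((h2.const_mul (1 / 2)).ae_eq (Eventually.of_forall fun x => ?_))
  change 1 / 2 * (v x * v x) = v x ^ 2 / 2
  ring

theorem coeFn_quad {v : L2 Ω} (h : MemLp v 4 (volume.restrict Ω)) :
    (quad v : E n → ℝ) =ᵐ[volume.restrict Ω] fun x => v x + v x ^ 2 / 2 := by
  rw [quad, dif_pos (memLp_quad h)]
  exact (memLp_quad h).coeFn_toLp

/-- The difference factors as `(v - w) + (v - w)(v + w)/2`, and Hölder with `1/4 + 1/4 = 1/2` bounds
the product. -/
theorem norm_quad_sub_le {v w : L2 Ω} (hv : MemLp v 4 (volume.restrict Ω))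
    (hw : MemLp w 4 (volume.restrict Ω)) :
    ‖quad v - quad w‖ ≤ ‖v - w‖ + (eLpNorm (v - w : L2 Ω) 4 (volume.restrict Ω)).toReal *
      ((eLpNorm v 4 (volume.restrict Ω)).toReal + (eLpNorm w 4 (volume.restrict Ω)).toReal) := by
  have := holderTriple_four
  have hd : MemLp (v - w : L2 Ω) 4 (volume.restrict Ω) := (memLp_congr_ae (Lp.coeFn_sub v w)).2
    (hv.sub hw)
  have hm : MemLp (fun x => (v - w : L2 Ω) x * (v x + w x)) 2 (volume.restrict Ω) :=
    (hv.add hw).mul' hd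
  have key : quad v - quad w = (v - w) + (1 / 2 : ℝ) • hm.toLp _ := by
    refine Lp.ext ?_
    filter_upwards [Lp.coeFn_sub (quad v) (quad w), coeFn_quad hv, coeFn_quad hw,
      Lp.coeFn_sub v w, Lp.coeFn_add (v - w) ((1 / 2 : ℝ) • hm.toLp _),
      Lp.coeFn_smul (1 / 2 : ℝ) (hm.toLp _), hm.coeFn_toLp] with x h1 h2 h3 h4 h5 h6 h7
    rw [h1, h5, Pi.sub_apply, Pi.add_apply, h2, h3, h6, Pi.smul_apply, h7, h4, Pi.sub_apply,
      smul_eq_mul]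
    ring
  rw [key]
  refine (norm_add_le _ _).trans (add_le_add_right ?_ _)
  rw [norm_smul, Lp.norm_toLp]
  have h1 : (eLpNorm (fun x => (v - w : L2 Ω) x * (v x + w x)) 2 (volume.restrict Ω)).toReal ≤
      (eLpNorm (v - w : L2 Ω) 4 (volume.restrict Ω)).toReal *
      ((eLpNorm v 4 (volume.restrict Ω)).toReal + (eLpNorm w 4 (volume.restrict Ω)).toReal) := by
    rw [← ENNReal.toReal_add hv.2.ne hw.2.ne, ← ENNReal.toReal_mul]
    refine ENNReal.toReal_mono (ENNReal.mul_ne_top hd.2.ne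
      (ENNReal.add_ne_top.2 ⟨hv.2.ne, hw.2.ne⟩)) ?_
    refine (eLpNorm_smul_le_mul_eLpNorm (p := 4) (q := 4) (r := 2) (hv.1.add hw.1) hd.1).trans ?_
    exact mul_le_mul_right (eLpNorm_add_le hv.1 hw.1 (by norm_num)) _
  have h2 : (0 : ℝ) ≤ (eLpNorm (fun x => (v - w : L2 Ω) x * (v x + w x)) 2
    (volume.restrict Ω)).toReal := ENNReal.toReal_nonneg
  rw [Real.norm_of_nonneg (by norm_num)]
  linarith

theorem quad_zero : quad (0 : L2 Ω) = 0 := by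
  have h : MemLp (0 : L2 Ω) 4 (volume.restrict Ω) :=
    (memLp_congr_ae (Lp.coeFn_zero ℝ 2 (volume.restrict Ω))).2 MemLp.zero
  refine Lp.ext ?_
  filter_upwards [coeFn_quad h, Lp.coeFn_zero ℝ 2 (volume.restrict Ω)] with x h1 h2
  rw [h1, h2]; simp

/-- `v ↦ v + v² / 2` is locally Lipschitz from `H²₀(Ω)` to `L²(Ω)`. -/
theorem exists_norm_quad_sub_le (hn : 1 ≤ n) (hn2 : n ≤ 2) (hΩ : IsOpen Ω)
    (hΩb : Bornology.IsBounded Ω) :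
    ∃ C : ℝ, 0 ≤ C ∧ ∀ v ∈ H20 Ω, ∀ w ∈ H20 Ω, ‖quad (fn v) - quad (fn w)‖ ≤
      C * (1 + ‖energyMap v‖ + ‖energyMap w‖) * ‖energyMap (v - w)‖ := by
  obtain ⟨C, hC, h⟩ := exists_L4_bound hn hn2 hΩ hΩb
  have h4 : ∀ v ∈ H20 Ω, (eLpNorm (fn v) 4 (volume.restrict Ω)).toReal
      ≤ 2 * C * n * ‖energyMap v‖ := fun v hv => by
    refine (h v hv).2.trans ?_
    have h1 : ∑ i, ‖grad v i‖ ≤ n * ‖v‖ := by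
      refine (Finset.sum_le_sum fun i _ => norm_grad_le v i).trans ?_
      simp
    calc C * ∑ i, ‖grad v i‖ ≤ C * (n * (2 * ‖energyMap v‖)) := by
          gcongr
          exact h1.trans (mul_le_mul_of_nonneg_left (norm_le_energyMap hΩ hv) (Nat.cast_nonneg n))
      _ = _ := by ring
  refine ⟨1 + (2 * C * n) ^ 2, by positivity, fun v hv w hw => ?_⟩
  have hd := (H20 Ω).sub_mem hv hw
  have h1 := norm_quad_sub_le (h v hv).1 (h w hw).1
  rw [← fn_sub] at h1
  have h2 : ‖fn (v - w)‖ ≤ ‖energyMap (v - w)‖ := by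
    refine le_of_sq_le_sq ?_ (norm_nonneg _)
    rw [norm_energyMap_sq]
    nlinarith [sq_nonneg ‖lap (v - w)‖]
  have h5 := mul_le_mul (h4 _ hd) (add_le_add (h4 v hv) (h4 w hw))
    (add_nonneg ENNReal.toReal_nonneg ENNReal.toReal_nonneg) (by positivity)
  refine (h1.trans (add_le_add h2 h5)).trans ?_
  have a1 := norm_nonneg (energyMap v)
  have a2 := norm_nonneg (energyMap w)
  have a3 := norm_nonneg (energyMap (v - w))
  nlinarith [mul_nonneg (add_nonneg a1 a2) a3, mul_nonneg (sq_nonneg (2 * C * n)) a3]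

theorem sum_g_mul_ae_eq {v : L2 Ω} (hv : MemLp v 4 (volume.restrict Ω)) :
    ∀ᵐ x ∂(volume.restrict Ω), ∀ y : Fin n → ℝ,
      ∑ i, g n (v x) i * y i = -∑ i, quad v x * y i := by
  filter_upwards [coeFn_quad hv] with x hx y
  rw [hx, ← Finset.sum_neg_distrib]
  refine Finset.sum_congr rfl fun i _ => ?_
  simp only [g]
  ring

theorem integrable_mul_L2 (v w : L2 Ω) : Integrable (fun x => v x * w x) (volume.restrict Ω) :=
  (Lp.memLp v).integrable_mul (Lp.memLp w)

theorem integral_g_mul {v : L2 Ω} (hv : MemLp v 4 (volume.restrict Ω)) {y : Fin n → L2 Ω}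
    {z : Fin n → E n → ℝ} (h : ∀ i, (y i : E n → ℝ) =ᵐ[volume.restrict Ω] z i) :
    ∫ x in Ω, ∑ i, g n (v x) i * z i x = -∑ i, ⟪quad v, y i⟫ := by
  have e1 : ∫ x in Ω, ∑ i, g n (v x) i * z i x = ∫ x in Ω, -∑ i, quad v x * y i x := by
    refine integral_congr_ae ?_
    filter_upwards [sum_g_mul_ae_eq hv, ae_all_iff.2 h] with x hx h'
    simp_rw [← h']
    rw [hx fun i => y i x]
  rw [e1, integral_neg, integral_finsetSum _ fun i _ => integrable_mul_L2 _ _]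
  simp_rw [L2.inner_eq_integral]

/-- The weak divergence of `g(v)` can be tested with every element of `H²₀(Ω)`. -/
theorem IsWeakDiv.inner_eq (hΩ : IsOpen Ω) {v w : L2 Ω} (hv : MemLp v 4 (volume.restrict Ω))
    (h : IsWeakDiv Ω (fun x => g n (v x)) w) {χ : H2 Ω} (hχ : χ ∈ H20 Ω) :
    ⟪w, fn χ⟫ = ∑ i, ⟪quad v, grad χ i⟫ := by
  refine H20_induction (P := fun χ => ⟪w, fn χ⟫ = ∑ i, ⟪quad v, grad χ i⟫) ?_ ?_ hχ
  · refine isClosed_eq (continuous_const.inner continuous_fn) ?_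
    exact continuous_finsetSum _ fun i _ => continuous_const.inner (continuous_grad i)
  · rintro f ⟨φ, hφ, hf⟩
    have h1 := h φ hφ
    have h2 := integral_g_mul hv fun i => grad_ae_eq hΩ hφ hf i
    rw [integral_mul_congr_right _ hf] at h1
    simp_rw [congrFun (fderiv_eq_partialD _ φ)] at h1
    rw [h2] at h1
    linarith

/-- `∫ (v + v²/2) ∂_i v = 0` for `v ∈ H²₀(Ω)`. -/
theorem inner_quad_grad_self (hn : 1 ≤ n) (hn2 : n ≤ 2) (hΩ : IsOpen Ω)
    (hΩb : Bornology.IsBounded Ω) {v : H2 Ω} (hv : v ∈ H20 Ω) (i : Fin n) :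
    ⟪quad (fn v), grad v i⟫ = 0 := by
  obtain ⟨C, hC, hL⟩ := exists_norm_quad_sub_le hn hn2 hΩ hΩb
  obtain ⟨C4, -, h4⟩ := exists_L4_bound hn hn2 hΩ hΩb
  obtain ⟨f, hf, hfv⟩ := exists_seq_testSubmodule hv
  -- The local Lipschitz bound makes the pairing continuous along the approximating sequence, so the
  -- identity need only be checked on test functions.
  have hq : Tendsto (fun k => quad (fn (f k))) atTop (𝓝 (quad (fn v))) := by
    rw [tendsto_iff_norm_sub_tendsto_zero]
    refine squeeze_zero (fun _ => norm_nonneg _)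
      (fun k => hL _ (testSubmodule_le_H20 (hf k)) _ hv) ?_
    have h1 : Tendsto (fun k => C * (1 + ‖energyMap (f k)‖ + ‖energyMap v‖) *
        ‖energyMap (f k - v)‖) atTop
        (𝓝 (C * (1 + ‖energyMap v‖ + ‖energyMap v‖) * ‖energyMap (v - v)‖)) := by
      have hc : Continuous fun w : H2 Ω => C * (1 + ‖energyMap w‖ + ‖energyMap v‖) *
        ‖energyMap (w - v)‖ := by fun_prop
      exact (hc.tendsto v).comp hfv
    simpa using h1
  have hlim := hq.inner (((continuous_grad i).tendsto v).comp hfv) (𝕜 := ℝ)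
  refine tendsto_nhds_unique hlim (tendsto_const_nhds.congr fun k => ?_)
  obtain ⟨φ, hφ, hk⟩ := hf k
  have hm := (h4 _ (testSubmodule_le_H20 (hf k))).1
  have hg := grad_ae_eq hΩ hφ hk i
  have hint : ∀ {f g : E n → ℝ}, IsTest Ω f → IsTest Ω g →
      Integrable (fun x => f x * g x) (volume.restrict Ω) := fun hf hg =>
    ((hf.1.continuous.mul hg.1.continuous).integrable_of_hasCompactSupport
      hf.2.1.mul_right).restrict
  have e1 : ∫ x in Ω, φ x * partialD (fun _ : Fin 1 => i) φ x = 0 := by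
    have := hφ.integral_mul_partialD hφ i
    simp_rw [mul_comm (partialD _ φ _)] at this
    linarith
  -- Integration by parts turns `I = ∫ φ² ∂_i φ` into `-2 I`.
  have e2 : ∫ x in Ω, (φ * φ) x * partialD (fun _ : Fin 1 => i) φ x = 0 := by
    have h1 := (hφ.mul hφ).integral_mul_partialD hφ i
    have h2 : ∀ x, partialD (fun _ : Fin 1 => i) (φ * φ) x * φ x
        = 2 * ((φ * φ) x * partialD (fun _ : Fin 1 => i) φ x) := fun x => by
      rw [← congrFun (fderiv_eq_partialD i (φ * φ)) x, ← congrFun (fderiv_eq_partialD i φ) x]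
      have hd := hφ.1.differentiable (by simp) x
      rw [fderiv_mul hd hd]
      simp; ring
    simp_rw [h2] at h1
    rw [integral_const_mul] at h1
    linarith
  have e3 : ⟪quad (fn (f k)), grad (f k) i⟫ = ∫ x in Ω,
      (φ x * partialD (fun _ : Fin 1 => i) φ x +
        1 / 2 * ((φ * φ) x * partialD (fun _ : Fin 1 => i) φ x)) := by
    rw [L2.inner_eq_integral]
    refine integral_congr_ae ?_
    filter_upwards [coeFn_quad hm, hk, hg] with x h1 h2 h3
    rw [h1, h2, h3, Pi.mul_apply]; ring
  change 0 = ⟪quad (fn (f k)), grad (f k) i⟫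
  rw [e3, integral_add (hint hφ (hφ.partialD i))
    ((hint (hφ.mul hφ) (hφ.partialD i)).const_mul _), integral_const_mul, e1, e2]
  simp

/-! ### The form of the right-hand side -/

/-- The form `α (∇v, ∇χ) + (g(v), ∇χ)`. -/
def spatialForm (α : ℝ) (v χ : H2 Ω) : ℝ :=
  α * ∑ i, ⟪grad v i, grad χ i⟫ - ∑ i, ⟪quad (fn v), grad χ i⟫

theorem spatialForm_zero (α : ℝ) (χ : H2 Ω) : spatialForm α 0 χ = 0 := by
  have : ∀ i : Fin n, grad (0 : H2 Ω) i = 0 := fun i => (gradL i).map_zero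
  simp [spatialForm, fn_zero, quad_zero, this]

/-- The nonlinear term drops out on the diagonal, leaving `α ‖∇v‖²`. -/
theorem spatialForm_self_nonneg (hn : 1 ≤ n) (hn2 : n ≤ 2) (hΩ : IsOpen Ω)
    (hΩb : Bornology.IsBounded Ω) {α : ℝ} (hα : 0 ≤ α) {v : H2 Ω} (hv : v ∈ H20 Ω) :
    0 ≤ spatialForm α v v := by
  rw [spatialForm, Finset.sum_eq_zero fun i _ => inner_quad_grad_self hn hn2 hΩ hΩb hv i, sub_zero]
  exact mul_nonneg hα (Finset.sum_nonneg fun i _ => real_inner_self_nonneg)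

theorem exists_abs_spatialForm_sub_le (hn : 1 ≤ n) (hn2 : n ≤ 2) (hΩ : IsOpen Ω)
    (hΩb : Bornology.IsBounded Ω) {α : ℝ} (hα : 0 ≤ α) :
    ∃ C : ℝ, 0 ≤ C ∧ ∀ v ∈ H20 Ω, ∀ w ∈ H20 Ω, ∀ χ ∈ H20 Ω,
      |spatialForm α v χ - spatialForm α w χ| ≤
      C * (1 + ‖energyMap v‖ + ‖energyMap w‖) * ‖energyMap (v - w)‖ * ‖energyMap χ‖ := by
  obtain ⟨C, hC, hL⟩ := exists_norm_quad_sub_le hn hn2 hΩ hΩb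
  refine ⟨n * (4 * α + 2 * C), by positivity, fun v hv w hw χ hχ => ?_⟩
  have hg : ∀ u ∈ H20 Ω, ∀ i, ‖grad u i‖ ≤ 2 * ‖energyMap u‖ := fun u hu i =>
    (norm_grad_le u i).trans (norm_le_energyMap hΩ hu)
  have e : spatialForm α v χ - spatialForm α w χ = ∑ i, (α * ⟪grad (v - w) i, grad χ i⟫
      - ⟪quad (fn v) - quad (fn w), grad χ i⟫) := by
    simp_rw [spatialForm, grad_sub, inner_sub_left]
    rw [Finset.sum_sub_distrib, Finset.sum_sub_distrib, ← Finset.mul_sum, Finset.sum_sub_distrib]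
    ring
  have a1 := norm_nonneg (energyMap v)
  have a2 := norm_nonneg (energyMap w)
  have a3 := norm_nonneg (energyMap (v - w))
  have a4 := norm_nonneg (energyMap χ)
  rw [e]
  refine (Finset.abs_sum_le_sum_abs _ _).trans ((Finset.sum_le_sum (g := fun _ =>
    (4 * α + 2 * C) * (1 + ‖energyMap v‖ + ‖energyMap w‖) * ‖energyMap (v - w)‖ * ‖energyMap χ‖)
    fun i _ => ?_).trans (le_of_eq ?_))
  · refine (abs_sub _ _).trans ?_
    rw [abs_mul, abs_of_nonneg hα]
    have h1 := (abs_real_inner_le_norm (grad (v - w) i) (grad χ i)).trans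
      (mul_le_mul (hg _ ((H20 Ω).sub_mem hv hw) i) (hg _ hχ i) (norm_nonneg _) (by positivity))
    have h2 := (abs_real_inner_le_norm (quad (fn v) - quad (fn w)) (grad χ i)).trans
      (mul_le_mul (hL v hv w hw) (hg _ hχ i) (norm_nonneg _) (by positivity))
    have h3 := mul_le_mul_of_nonneg_left h1 hα
    have h4 : 0 ≤ α * (‖energyMap v‖ + ‖energyMap w‖) * (‖energyMap (v - w)‖ * ‖energyMap χ‖) := by
      positivity
    nlinarith
  · simp; ring

end

end RosenauBurgers

/-! ### Abstract flow, scheme and error analysis. -/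

namespace RosenauBurgers

noncomputable section

/-! ### Abstract nonlinear evolution equations with a locally Lipschitz right-hand side -/

/-- Over `N + 1` equal pieces the increments add up to `O(1/N)`. This replaces differentiation of
the energy in time. -/
theorem le_of_sub_le_mul_sq {f : ℝ → ℝ} {a b C : ℝ} (hab : a ≤ b)
    (h : ∀ s t, a ≤ s → s ≤ t → t ≤ b → f t - f s ≤ C * (t - s) ^ 2) : f b ≤ f a := by
  have key : ∀ N : ℕ, f b - f a ≤ C * (b - a) ^ 2 / (N + 1 : ℝ) := fun N => by
    have hN : (0 : ℝ) < N + 1 := by positivity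
    set δ : ℝ := (b - a) / (N + 1) with hδ
    have hδ0 : 0 ≤ δ := div_nonneg (sub_nonneg.2 hab) hN.le
    have hδN : (N + 1) * δ = b - a := by rw [hδ]; field_simp
    have hsum := Finset.sum_range_sub (fun i : ℕ => f (a + i * δ)) (N + 1)
    have hle : ∑ i ∈ Finset.range (N + 1), (f (a + (i + 1 : ℕ) * δ) - f (a + i * δ)) ≤
        ∑ i ∈ Finset.range (N + 1), C * δ ^ 2 := by
      refine Finset.sum_le_sum fun i hi => ?_
      have hi' : (i : ℝ) + 1 ≤ N + 1 := by
        have := Finset.mem_range.1 hi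
        exact_mod_cast this
      have h1 := h (a + i * δ) (a + (i + 1 : ℕ) * δ) (by linarith [mul_nonneg i.cast_nonneg hδ0])
        (by push_cast; linarith) (by push_cast; nlinarith [mul_le_mul_of_nonneg_right hi' hδ0])
      refine h1.trans (le_of_eq ?_)
      push_cast; ring
    rw [hsum] at hle
    simp only [Finset.sum_const, Finset.card_range, nsmul_eq_mul, Nat.cast_add, Nat.cast_one,
      Nat.cast_zero, zero_mul, add_zero, hδN, add_sub_cancel] at hle
    refine hle.trans (le_of_eq ?_)
    rw [hδ]; field_simp
  have hlim : Tendsto (fun N : ℕ => C * (b - a) ^ 2 / (N + 1 : ℝ)) atTop (𝓝 0) :=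
    tendsto_const_nhds.div_atTop
      (tendsto_atTop_add_const_right _ _ tendsto_natCast_atTop_atTop)
  have := ge_of_tendsto' hlim key
  linarith

variable {V Y : Type*} [AddCommGroup V] [Module ℝ V] [NormedAddCommGroup Y]
  [InnerProductSpace ℝ Y]

/-- A form `b` on `W` that is locally Lipschitz in its first argument with respect to the
seminorm `‖ι ·‖`, vanishes at `0` and is nonnegative on the diagonal. -/
structure IsLocLipForm (ι : V →ₗ[ℝ] Y) (W : Submodule ℝ V) (b : V → V → ℝ) (c : ℝ) : Prop where
  c_nonneg : 0 ≤ c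
  lip : ∀ v ∈ W, ∀ w ∈ W, ∀ χ ∈ W,
    |b v χ - b w χ| ≤ c * (1 + ‖ι v‖ + ‖ι w‖) * ‖ι (v - w)‖ * ‖ι χ‖
  zero : ∀ χ, b 0 χ = 0
  nonneg : ∀ v ∈ W, 0 ≤ b v v

/-- `u` solves `⟪ι u', ι χ⟫ + b(u, χ) = 0` on `[0, T]`, in integrated form: over a short time
interval the integral of `b(u, χ)` is compared with a constant value `b(v, χ)`. -/
structure IsFlow (ι : V →ₗ[ℝ] Y) (W : Submodule ℝ V) (b : V → V → ℝ) (c T : ℝ) (u : ℝ → V) :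
    Prop where
  mem : ∀ t ∈ Icc 0 T, u t ∈ W
  bdd : ∃ B, ∀ t ∈ Icc 0 T, ‖ι (u t)‖ ≤ B
  eqn : ∀ s t, 0 ≤ s → s ≤ t → t ≤ T → ∀ v ∈ W, ∀ χ ∈ W, ∀ D,
    (∀ τ ∈ Icc s t, c * (1 + ‖ι (u τ)‖ + ‖ι v‖) * ‖ι (u τ - v)‖ ≤ D) →
    |⟪ι (u t - u s), ι χ⟫ + (t - s) * b v χ| ≤ (t - s) * D * ‖ι χ‖

theorem le_of_sq_le_mul {x y : ℝ} (hx : 0 ≤ x) (hy : 0 ≤ y) (h : x ^ 2 ≤ y * x) : x ≤ y := by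
  rcases hx.eq_or_lt with h0 | h0
  · rwa [← h0]
  · exact le_of_mul_le_mul_right (by rwa [← sq]) h0

variable {ι : V →ₗ[ℝ] Y} {W S : Submodule ℝ V} {b : V → V → ℝ} {c T : ℝ} {u : ℝ → V}

/-- The equation is tested with the increment itself and compared with `v = 0`, where `b` vanishes.
-/
theorem IsFlow.norm_sub_le (hb : IsLocLipForm ι W b c) (hu : IsFlow ι W b c T u) {s t M : ℝ}
    (hs : 0 ≤ s) (hst : s ≤ t) (ht : t ≤ T) (hM : ∀ τ ∈ Icc s t, ‖ι (u τ)‖ ≤ M) :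
    ‖ι (u t - u s)‖ ≤ (t - s) * (c * (1 + M) * M) := by
  have hc := hb.c_nonneg
  have hM0 : 0 ≤ M := (norm_nonneg _).trans (hM s ⟨le_rfl, hst⟩)
  have hd : u t - u s ∈ W := W.sub_mem (hu.mem t ⟨hs.trans hst, ht⟩) (hu.mem s ⟨hs, hst.trans ht⟩)
  have h := hu.eqn s t hs hst ht 0 W.zero_mem _ hd (c * (1 + M) * M) fun τ hτ => by
    have := hM τ hτ
    rw [map_zero, norm_zero, add_zero, sub_zero]
    gcongr
  rw [hb.zero, mul_zero, add_zero, real_inner_self_eq_norm_sq, abs_of_nonneg (sq_nonneg _)] at h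
  have := sub_nonneg.2 hst
  exact le_of_sq_le_mul (norm_nonneg _) (by positivity) h

/-- Testing with `u(t')` and freezing `b` at `u(t')`, where it is nonnegative, leaves only the
freezing error. This is quadratic in the step because `u` is Lipschitz in time, so
`le_of_sub_le_mul_sq` removes it. -/
theorem IsFlow.norm_antitone (hb : IsLocLipForm ι W b c) (hu : IsFlow ι W b c T u) {s t : ℝ}
    (hs : 0 ≤ s) (hst : s ≤ t) (ht : t ≤ T) : ‖ι (u t)‖ ≤ ‖ι (u s)‖ := by
  have hc := hb.c_nonneg
  obtain ⟨B, hB⟩ := hu.bdd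
  have hB0 : 0 ≤ B := (norm_nonneg _).trans (hB s ⟨hs, hst.trans ht⟩)
  refine le_of_sq_le_sq ?_ (norm_nonneg _)
  refine le_of_sub_le_mul_sq (f := fun t => ‖ι (u t)‖ ^ 2)
    (C := 2 * (c * (1 + B + B) * (c * (1 + B) * B) * B)) hst fun s' t' h1 h2 h3 => ?_
  have hs' : 0 ≤ s' := hs.trans h1
  have ht' : t' ≤ T := h3.trans ht
  have hbd : ∀ τ ∈ Icc s' t', ‖ι (u τ)‖ ≤ B := fun τ hτ =>
    hB τ ⟨hs'.trans hτ.1, hτ.2.trans ht'⟩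
  have hmem := hu.mem t' ⟨hs'.trans h2, ht'⟩
  have hδ := sub_nonneg.2 h2
  have hBt := hbd t' ⟨h2, le_rfl⟩
  have h := hu.eqn s' t' hs' h2 ht' _ hmem _ hmem
    (c * (1 + B + B) * ((t' - s') * (c * (1 + B) * B))) fun τ hτ => by
      have h4 := hu.norm_sub_le hb (hs'.trans hτ.1) hτ.2 ht' fun σ hσ =>
        hbd σ ⟨hτ.1.trans hσ.1, hσ.2⟩
      have h5 : (t' - τ) * (c * (1 + B) * B) ≤ (t' - s') * (c * (1 + B) * B) := by
        have := hτ.1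
        gcongr
      rw [← neg_sub, map_neg, norm_neg]
      have h6 := hbd τ hτ
      have h7 := h4.trans h5
      gcongr
  have h8 := (abs_le.1 h).2
  have h9 := mul_nonneg hδ (hb.nonneg _ hmem)
  have h10 : ‖ι (u t')‖ ^ 2 - ‖ι (u s')‖ ^ 2 ≤ 2 * ⟪ι (u t' - u s'), ι (u t')⟫ := by
    have h11 := sq_nonneg ‖ι (u t') - ι (u s')‖
    rw [norm_sub_sq_real, real_inner_comm] at h11
    rw [map_sub, inner_sub_left, real_inner_self_eq_norm_sq]
    linarith
  have h12 : (t' - s') * (c * (1 + B + B) * ((t' - s') * (c * (1 + B) * B))) * ‖ι (u t')‖ ≤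
      (t' - s') * (c * (1 + B + B) * ((t' - s') * (c * (1 + B) * B))) * B :=
    mul_le_mul_of_nonneg_left hBt (by positivity)
  change ‖ι (u t')‖ ^ 2 - ‖ι (u s')‖ ^ 2 ≤ _
  nlinarith

/-- By monotonicity the bound is proportional to the norm at the left endpoint. This proportionality
is what makes estimates backwards in time possible. -/
theorem IsFlow.norm_sub_le' (hb : IsLocLipForm ι W b c) (hu : IsFlow ι W b c T u) {s t L : ℝ}
    (hs : 0 ≤ s) (hst : s ≤ t) (ht : t ≤ T) (hL : c * (1 + ‖ι (u 0)‖) ≤ L) :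
    ‖ι (u t - u s)‖ ≤ (t - s) * (L * ‖ι (u s)‖) := by
  have hc := hb.c_nonneg
  refine (hu.norm_sub_le hb hs hst ht fun τ hτ =>
    hu.norm_antitone hb hs hτ.1 (hτ.2.trans ht)).trans ?_
  have h0 := hu.norm_antitone hb le_rfl hs (hst.trans ht)
  have hδ := sub_nonneg.2 hst
  have : c * (1 + ‖ι (u s)‖) ≤ L := le_trans (by gcongr) hL
  gcongr

/-- The norm of a solution at time `0` is controlled by its norm at any later time. -/
theorem IsFlow.norm_zero_le (hb : IsLocLipForm ι W b c) (hu : IsFlow ι W b c T u) {L : ℝ}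
    (hL : c * (1 + ‖ι (u 0)‖) ≤ L) {J : ℕ} (hJ : 0 < J) (hJL : L * T / J ≤ 1 / 2) {t : ℝ}
    (ht : t ∈ Icc 0 T) : ‖ι (u 0)‖ ≤ 2 ^ J * ‖ι (u t)‖ := by
  have hT : 0 ≤ T := ht.1.trans ht.2
  have hJ' : (0 : ℝ) < J := Nat.cast_pos.2 hJ
  set δ := T / J with hδ
  have hδ0 : 0 ≤ δ := div_nonneg hT hJ'.le
  have hδJ : J * δ = T := by rw [hδ]; field_simp
  have hLδ : δ * L ≤ 1 / 2 := by
    refine le_trans (le_of_eq ?_) hJL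
    rw [hδ]; ring
  -- On a step of length `δ` with `δ L ≤ 1/2` the solution moves by at most half its norm, so the
  -- norm shrinks at most by a factor 2.
  have key : ∀ j : ℕ, j ≤ J → ‖ι (u 0)‖ ≤ 2 ^ j * ‖ι (u (j * δ))‖ := by
    intro j
    induction j with
    | zero => intro _; simp
    | succ j ih =>
      intro hj
      have h1 := ih (by omega)
      have hj' : (j : ℝ) + 1 ≤ J := by exact_mod_cast hj
      have hs : 0 ≤ (j : ℝ) * δ := by positivity
      have h2 := hu.norm_sub_le' hb hs (t := (j + 1 : ℕ) * δ) (by push_cast; nlinarith)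
        (by push_cast; rw [← hδJ]; gcongr) hL
      have h3 : ((j + 1 : ℕ) * δ - j * δ) = δ := by push_cast; ring
      rw [h3] at h2
      have h4 : ‖ι (u (j * δ))‖ ≤ ‖ι (u ((j + 1 : ℕ) * δ))‖
          + ‖ι (u ((j + 1 : ℕ) * δ) - u (j * δ))‖ := by
        rw [map_sub]
        have := _root_.norm_sub_le (ι (u ((j + 1 : ℕ) * δ))) (ι (u ((j + 1 : ℕ) * δ)) - ι (u (j * δ)))
        rwa [sub_sub_cancel] at this
      have h5 : δ * (L * ‖ι (u (j * δ))‖) ≤ 1 / 2 * ‖ι (u (j * δ))‖ := by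
        rw [← mul_assoc]
        gcongr
      have h6 : ‖ι (u (j * δ))‖ ≤ 2 * ‖ι (u ((j + 1 : ℕ) * δ))‖ := by linarith
      calc ‖ι (u 0)‖ ≤ 2 ^ j * ‖ι (u (j * δ))‖ := h1
        _ ≤ 2 ^ j * (2 * ‖ι (u ((j + 1 : ℕ) * δ))‖) := by gcongr
        _ = _ := by ring
  have h := key J le_rfl
  rw [hδJ] at h
  have h' := hu.norm_antitone hb ht.1 ht.2 le_rfl
  exact h.trans (by gcongr)

/-! ### The Galerkin backward Euler scheme -/

/-- `U` solves the backward Euler scheme `⟪ι (U^{m+1} - U^m), ι χ⟫ + k b(U^{m+1}, χ) = 0` in `S`. -/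
structure IsScheme (ι : V →ₗ[ℝ] Y) (S : Submodule ℝ V) (b : V → V → ℝ) (k : ℝ) (N : ℕ)
    (U : ℕ → V) : Prop where
  mem : ∀ m ≤ N, U m ∈ S
  step : ∀ m < N, ∀ χ ∈ S, ⟪ι (U (m + 1) - U m), ι χ⟫ + k * b (U (m + 1)) χ = 0

/-- `P` is the orthogonal projection onto `S` with respect to `⟪ι ·, ι ·⟫`. -/
structure IsOrthProj (ι : V →ₗ[ℝ] Y) (S : Submodule ℝ V) (P : V → V) : Prop where
  mem : ∀ v, P v ∈ S
  orth : ∀ v, ∀ χ ∈ S, ⟪ι (v - P v), ι χ⟫ = 0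

/-- The finite-dimensional image of `S` under `ι` has an orthogonal complement, and preimages of the
projected vectors are chosen. Injectivity of `ι` and linearity of `P` are not required. -/
theorem exists_isOrthProj (ι : V →ₗ[ℝ] Y) (S : Submodule ℝ V) [FiniteDimensional ℝ S] :
    ∃ P, IsOrthProj ι S P := by
  have : ∀ v, ∃ p, p ∈ S ∧ ∀ χ ∈ S, ⟪ι (v - p), ι χ⟫ = 0 := fun v => by
    obtain ⟨y, hy, z, hz, hv⟩ := (S.map ι).exists_add_mem_mem_orthogonal (ι v)
    obtain ⟨p, hp, rfl⟩ := hy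
    refine ⟨p, hp, fun χ hχ => ?_⟩
    rw [map_sub, hv, add_sub_cancel_left]
    exact Submodule.inner_left_of_mem_orthogonal (Submodule.mem_map_of_mem hχ) hz
  choose P hP using this
  exact ⟨P, fun v => (hP v).1, fun v => (hP v).2⟩

variable {P : V → V} {k : ℝ} {N : ℕ} {U : ℕ → V}

theorem IsOrthProj.norm_sub_le (hP : IsOrthProj ι S P) (v : V) {φ : V} (hφ : φ ∈ S) :
    ‖ι (v - P v)‖ ≤ ‖ι (v - φ)‖ := by
  refine le_of_sq_le_mul (norm_nonneg _) (norm_nonneg _) ?_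
  have h := hP.orth v (P v - φ) (S.sub_mem (hP.mem v) hφ)
  have e : ‖ι (v - P v)‖ ^ 2 = ⟪ι (v - φ), ι (v - P v)⟫ := by
    have : ι (v - φ) = ι (v - P v) + ι (P v - φ) := by rw [← map_add, sub_add_sub_cancel]
    rw [this, inner_add_left, real_inner_self_eq_norm_sq, real_inner_comm, h, add_zero]
  rw [e]
  exact real_inner_le_norm _ _

/-- The vector `P v - φ` is the projection of `v - φ`, and projections do not increase the norm. -/
theorem IsOrthProj.norm_proj_sub_le (hP : IsOrthProj ι S P) (v : V) {φ : V} (hφ : φ ∈ S) :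
    ‖ι (P v - φ)‖ ≤ ‖ι (v - φ)‖ := by
  refine le_of_sq_le_mul (norm_nonneg _) (norm_nonneg _) ?_
  have h := hP.orth v (P v - φ) (S.sub_mem (hP.mem v) hφ)
  have e : ‖ι (P v - φ)‖ ^ 2 = ⟪ι (v - φ), ι (P v - φ)⟫ := by
    have : ι (v - φ) = ι (v - P v) + ι (P v - φ) := by rw [← map_add, sub_add_sub_cancel]
    rw [this, inner_add_left, real_inner_self_eq_norm_sq, h, zero_add]
  rw [e]
  exact real_inner_le_norm _ _

/-- The distance to `S` is 1-Lipschitz; later this compares projection errors at different times. -/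
theorem IsOrthProj.norm_sub_le_add (hP : IsOrthProj ι S P) (v w : V) :
    ‖ι (v - P v)‖ ≤ ‖ι (w - P w)‖ + ‖ι (v - w)‖ := by
  refine (hP.norm_sub_le v (hP.mem w)).trans ?_
  rw [← sub_add_sub_cancel v w (P w), map_add, add_comm]
  exact norm_add_le _ _

/-- Stability for every step size: the step is tested with `U^{m+1}`, and `b` is nonnegative on the
diagonal. -/
theorem IsScheme.norm_le (hb : IsLocLipForm ι W b c) (hSW : S ≤ W) (hk : 0 ≤ k)
    (hU : IsScheme ι S b k N U) : ∀ m ≤ N, ‖ι (U m)‖ ≤ ‖ι (U 0)‖ := by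
  intro m
  induction m with
  | zero => intro _; exact le_rfl
  | succ m ih =>
    intro hm
    refine le_trans ?_ (ih (by omega))
    have hmem := hU.mem (m + 1) hm
    have h := hU.step m hm _ hmem
    have h1 := mul_nonneg hk (hb.nonneg _ (hSW hmem))
    rw [map_sub, inner_sub_left, real_inner_self_eq_norm_sq] at h
    refine le_of_sq_le_mul (norm_nonneg _) (norm_nonneg _) ?_
    have := real_inner_le_norm (ι (U m)) (ι (U (m + 1)))
    linarith

theorem IsScheme.norm_sub_le (hb : IsLocLipForm ι W b c) (hSW : S ≤ W) (hk : 0 ≤ k)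
    (hU : IsScheme ι S b k N U) {m : ℕ} (hm : m < N) {M : ℝ} (hM : ‖ι (U (m + 1))‖ ≤ M) :
    ‖ι (U (m + 1) - U m)‖ ≤ k * (c * (1 + M) * M) := by
  have hc := hb.c_nonneg
  have hM0 := (norm_nonneg _).trans hM
  have h1 := hU.mem (m + 1) hm
  have hd := S.sub_mem h1 (hU.mem m hm.le)
  have h := hU.step m hm _ hd
  have h2 := hb.lip _ (hSW h1) 0 W.zero_mem _ (hSW hd)
  rw [hb.zero, sub_zero, sub_zero, map_zero, norm_zero, add_zero] at h2
  rw [real_inner_self_eq_norm_sq] at h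
  have h3 : c * (1 + ‖ι (U (m + 1))‖) * ‖ι (U (m + 1))‖ ≤ c * (1 + M) * M := by gcongr
  refine le_of_sq_le_mul (norm_nonneg _) (by positivity) ?_
  have h4 := h2.trans (mul_le_mul_of_nonneg_right h3 (norm_nonneg _))
  have h5 := mul_le_mul_of_nonneg_left (neg_le_abs (b (U (m + 1)) (U (m + 1) - U m))|>.trans h4) hk
  linarith

/-- One step of the error recursion. -/
theorem norm_error_step (hb : IsLocLipForm ι W b c) (hSW : S ≤ W) (hk : 0 ≤ k)
    (hu : IsFlow ι W b c T u) (hU : IsScheme ι S b k N U) (hP : IsOrthProj ι S P)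
    {M M' L : ℝ} (hM : ‖ι (u 0)‖ ≤ M) (hM' : ‖ι (U 0)‖ ≤ M') (hL : c * (1 + M + M') ≤ L)
    {m : ℕ} (hm : m < N) (hT : (m + 1 : ℕ) * k ≤ T) :
    ‖ι (P (u ((m + 1 : ℕ) * k)) - U (m + 1))‖ ≤ (1 + k * L) * ‖ι (P (u (m * k)) - U m)‖
      + k * L * (‖ι (u (m * k) - P (u (m * k)))‖ + k * L * (M + M')) := by
  have hc := hb.c_nonneg
  have hM0 := (norm_nonneg _).trans hM
  have hM0' := (norm_nonneg _).trans hM'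
  have hL0 : 0 ≤ L := le_trans (by positivity) hL
  set s : ℝ := m * k with hs
  set t : ℝ := (m + 1 : ℕ) * k with ht
  have hts : t - s = k := by rw [hs, ht]; push_cast; ring
  have hs0 : 0 ≤ s := by positivity
  have hst : s ≤ t := by linarith
  have hUS := hU.mem (m + 1) hm
  have hUm := (hU.norm_le hb hSW hk (m + 1) hm).trans hM'
  set θ := P (u t) - U (m + 1) with hθ
  set x := ‖ι (P (u s) - U m)‖ with hx
  set ρ := ‖ι (u s - P (u s))‖ with hρ
  have hθS : θ ∈ S := S.sub_mem (hP.mem _) hUS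
  have hum : ∀ τ ∈ Icc s t, ‖ι (u τ)‖ ≤ M := fun τ hτ =>
    (hu.norm_antitone hb le_rfl (hs0.trans hτ.1) (hτ.2.trans hT)).trans hM
  have hUd : ‖ι (U (m + 1) - U m)‖ ≤ k * (L * M') := by
    refine (hU.norm_sub_le hb hSW hk hm hUm).trans ?_
    have : c * (1 + M') ≤ L := le_trans (mul_le_mul_of_nonneg_left (by linarith) hc) hL
    gcongr
  -- The distance is expressed through the error at the old level `m`, since both `u` and `U` move
  -- by `O(k)`. The recursion becomes explicit and needs no smallness of `k`.
  have hD : ∀ τ ∈ Icc s t, ‖ι (u τ - U (m + 1))‖ ≤ x + ρ + k * L * (M + M') := fun τ hτ => by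
    have h1 : ‖ι (u τ - u s)‖ ≤ k * (L * M) := by
      refine (hu.norm_sub_le hb hs0 hτ.1 (hτ.2.trans hT) fun σ hσ =>
        hum σ ⟨hσ.1, hσ.2.trans hτ.2⟩).trans ?_
      have h2 : c * (1 + M) ≤ L := le_trans (mul_le_mul_of_nonneg_left (by linarith) hc) hL
      have h3 : τ - s ≤ k := by linarith [hτ.2]
      gcongr
    have e : u τ - U (m + 1) = (u τ - u s) + (u s - P (u s)) + (P (u s) - U m)
        - (U (m + 1) - U m) := by abel
    rw [e, map_sub, map_add, map_add]
    refine (norm_sub_le _ _).trans ?_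
    have := norm_add₃_le (a := ι (u τ - u s)) (b := ι (u s - P (u s))) (c := ι (P (u s) - U m))
    linarith
  have h := hu.eqn s t hs0 hst hT _ (hSW hUS) θ (hSW hθS) (L * (x + ρ + k * L * (M + M')))
    fun τ hτ => by
      have h1 := hD τ hτ
      have h2 := hum τ hτ
      have : c * (1 + ‖ι (u τ)‖ + ‖ι (U (m + 1))‖) ≤ L := le_trans (by gcongr) hL
      gcongr
  have hstep := hU.step m hm θ hθS
  rw [hts] at h
  have h1 := (abs_le.1 h).2
  -- The projection errors at both time levels are orthogonal to `θ`, so no time difference of `u -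
  -- Pu` has to be estimated.
  have e1 := hP.orth (u t) θ hθS
  have e2 := hP.orth (u s) θ hθS
  have e3 : ‖ι θ‖ ^ 2 = ⟪ι (P (u s) - U m), ι θ⟫ + ⟪ι (u t - u s), ι θ⟫
      - ⟪ι (U (m + 1) - U m), ι θ⟫ - ⟪ι (u t - P (u t)), ι θ⟫ + ⟪ι (u s - P (u s)), ι θ⟫ := by
    rw [← real_inner_self_eq_norm_sq, ← inner_add_left, ← inner_sub_left, ← inner_sub_left,
      ← inner_add_left]
    congr 1
    simp only [hθ, map_sub]
    abel
  have h4 := real_inner_le_norm (ι (P (u s) - U m)) (ι θ)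
  refine le_of_sq_le_mul (norm_nonneg _) (by positivity) ?_
  rw [e3, e1, e2]
  nlinarith

/-- Discrete Gronwall inequality, from `1 + κ ≤ exp κ`. -/
theorem le_exp_of_recursion {x y : ℕ → ℝ} {κ : ℝ} {N : ℕ} (hκ : 0 ≤ κ) (hy : ∀ m, 0 ≤ y m)
    (hx : 0 ≤ x 0) (h : ∀ m < N, x (m + 1) ≤ (1 + κ) * x m + y m) :
    ∀ m ≤ N, x m ≤ Real.exp (N * κ) * (x 0 + ∑ j ∈ Finset.range N, y j) := by
  have key : ∀ m ≤ N, x m ≤ (1 + κ) ^ m * (x 0 + ∑ j ∈ Finset.range m, y j) := by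
    intro m
    induction m with
    | zero => intro _; simp
    | succ m ih =>
      intro hm
      have h1 := h m hm
      have h2 := mul_le_mul_of_nonneg_left (ih (by omega)) (by positivity : 0 ≤ 1 + κ)
      have h3 : y m ≤ (1 + κ) ^ (m + 1) * y m :=
        le_mul_of_one_le_left (hy m) (one_le_pow₀ (by linarith))
      rw [Finset.sum_range_succ, pow_succ] at *
      nlinarith
  intro m hm
  refine (key m hm).trans ?_
  have hsum : ∑ j ∈ Finset.range m, y j ≤ ∑ j ∈ Finset.range N, y j :=
    Finset.sum_le_sum_of_subset_of_nonneg (Finset.range_mono hm) fun j _ _ => hy j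
  have h0 : 0 ≤ ∑ j ∈ Finset.range m, y j := Finset.sum_nonneg fun j _ => hy j
  have hpow : (1 + κ) ^ m ≤ Real.exp (N * κ) := by
    rw [Real.exp_nat_mul]
    refine (pow_le_pow_right₀ (by linarith) hm).trans ?_
    exact pow_le_pow_left₀ (by linarith) (by linarith [Real.add_one_le_exp κ]) N
  gcongr

/-- The error of the scheme is bounded by the distances of the solution from `S` and by `k`. -/
theorem norm_error_le (hb : IsLocLipForm ι W b c) (hSW : S ≤ W) (hN : 1 ≤ N) (hT : 0 ≤ T)
    (hkT : N * k = T) (hu : IsFlow ι W b c T u) (hU : IsScheme ι S b k N U)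
    (hP : IsOrthProj ι S P) {A L : ℝ} (hA : 0 ≤ A)
    (hU0 : ‖ι (u 0 - U 0)‖ ≤ A * ‖ι (u 0 - P (u 0))‖)
    (hL : c * (1 + ‖ι (u 0)‖ + (1 + A) * ‖ι (u 0)‖) ≤ L) {m : ℕ} (hm : m ≤ N) :
    ‖ι (u (m * k) - U m)‖ ≤ ‖ι (u (m * k) - P (u (m * k)))‖ +
      Real.exp (L * T) * (A + L + L * T + L ^ 2 * T * (2 + A)) * (‖ι (u 0 - P (u 0))‖ +
        k * ∑ j ∈ Finset.Icc 1 N, ‖ι (u (j * k) - P (u (j * k)))‖ + k * ‖ι (u 0)‖) := by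
  have hc := hb.c_nonneg
  have hN' : (1 : ℝ) ≤ N := by exact_mod_cast hN
  have hk : 0 ≤ k := by
    by_contra! h
    nlinarith
  have hkT' : k ≤ T := by nlinarith
  set M := ‖ι (u 0)‖ with hM
  have hM0 : 0 ≤ M := norm_nonneg _
  have hL0 : 0 ≤ L := le_trans (by positivity) hL
  set ρ : ℕ → ℝ := fun j => ‖ι (u (j * k) - P (u (j * k)))‖ with hρ
  have hρn : ∀ j, 0 ≤ ρ j := fun j => norm_nonneg _
  have hρ0 : ‖ι (u 0 - P (u 0))‖ = ρ 0 := by simp [hρ]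
  have hρM : ρ 0 ≤ M := by
    rw [← hρ0]
    simpa using hP.norm_sub_le (u 0) S.zero_mem
  rw [hρ0] at hU0 ⊢
  -- Since `0 ∈ S`, the initial projection error is at most `M`, hence the initial error is at most
  -- `A M`.
  have hUn : ‖ι (U 0)‖ ≤ (1 + A) * M := by
    have h1 : ‖ι (U 0)‖ ≤ ‖ι (u 0)‖ + ‖ι (u 0 - U 0)‖ := by
      rw [map_sub]
      have := norm_sub_le (ι (u 0)) (ι (u 0) - ι (U 0))
      rwa [sub_sub_cancel] at this
    nlinarith [mul_le_mul_of_nonneg_left hρM hA]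
  have hrec := le_exp_of_recursion (x := fun m : ℕ => ‖ι (P (u (m * k)) - U m)‖)
    (y := fun m => k * L * (ρ m + k * L * (M + (1 + A) * M))) (κ := k * L) (N := N)
    (by positivity) (fun m => by have := hρn m; positivity) (norm_nonneg _)
    (fun m hm' => by
      refine norm_error_step hb hSW hk hu hU hP hM.symm.le hUn hL hm' ?_
      rw [← hkT]
      have : ((m + 1 : ℕ) : ℝ) ≤ N := by exact_mod_cast hm'
      gcongr) m hm
  have hx0 : ‖ι (P (u ((0 : ℕ) * k)) - U 0)‖ ≤ A * ρ 0 := by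
    rw [Nat.cast_zero, zero_mul]
    exact (hP.norm_proj_sub_le _ (hU.mem 0 (Nat.zero_le _))).trans hU0
  have hsum : ∑ j ∈ Finset.range N, k * L * (ρ j + k * L * (M + (1 + A) * M)) ≤
      k * L * (ρ 0 + ∑ j ∈ Finset.Icc 1 N, ρ j) + L ^ 2 * T * (2 + A) * (k * M) := by
    rw [← Finset.mul_sum, Finset.sum_add_distrib]
    -- The recursion uses the levels `0, …, N - 1`, the target sum `1, …, N`: `ρ 0` is split off and
    -- `ρ N ≥ 0` is added.
    have h1 : ∑ j ∈ Finset.range N, ρ j ≤ ρ 0 + ∑ j ∈ Finset.Icc 1 N, ρ j := by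
      have h2 : Finset.Icc 1 N = Finset.Ico (0 + 1) (N + 1) := by
        ext j; simp only [Finset.mem_Ico, Finset.mem_Icc]; omega
      rw [h2, ← Finset.sum_eq_sum_Ico_succ_bot (by omega), ← Finset.range_eq_Ico,
        Finset.sum_range_succ]
      linarith [hρn N]
    have h2 : ∑ j ∈ Finset.range N, k * L * (M + (1 + A) * M) = T * L * ((2 + A) * M) := by
      rw [Finset.sum_const, Finset.card_range, nsmul_eq_mul, ← hkT]; ring
    rw [h2]
    have := mul_le_mul_of_nonneg_left h1 (by positivity : 0 ≤ k * L)
    nlinarith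
  have hSm : 0 ≤ ∑ j ∈ Finset.Icc 1 N, ρ j := Finset.sum_nonneg fun j _ => hρn j
  have e : u (m * k) - U m = (u (m * k) - P (u (m * k))) + (P (u (m * k)) - U m) := by abel
  have hE : N * (k * L) = L * T := by rw [← hkT]; ring
  rw [e, map_add]
  refine (norm_add_le _ _).trans (add_le_add le_rfl (hrec.trans ?_))
  rw [hE, mul_assoc (Real.exp _)]
  refine mul_le_mul_of_nonneg_left ?_ (Real.exp_pos _).le
  refine (add_le_add hx0 hsum).trans ?_
  have p1 := hρn 0
  have p2 : 0 ≤ k * M := by positivity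
  have p3 : 0 ≤ k * ∑ j ∈ Finset.Icc 1 N, ρ j := by positivity
  have q1 : k * L * ρ 0 ≤ L * T * ρ 0 := by
    rw [mul_comm k]; gcongr
  have q2 : 0 ≤ L * T := by positivity
  have q3 : 0 ≤ L ^ 2 * T * (2 + A) := by positivity
  set ρSum := ∑ j ∈ Finset.Icc 1 N, ρ j
  nlinarith [mul_nonneg (add_nonneg hL0 q3) p1, mul_nonneg (add_nonneg hA (add_nonneg q2 q3)) p3,
    mul_nonneg (add_nonneg hA (add_nonneg hL0 q2)) p2]

/-- Averaging `ρ₀ ≤ ρ_m + m k D` over the first `√N` indices. -/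
theorem sqrt_mul_le_of_le_add {N : ℕ} {k D : ℝ} {ρ : ℕ → ℝ} (hN : 1 ≤ N) (hkD : 0 ≤ k * D)
    (hρ0 : ∀ m, 0 ≤ ρ m) (hρ : ∀ m ∈ Finset.Icc 1 N, ρ 0 ≤ ρ m + m * (k * D)) :
    Real.sqrt N * ρ 0 ≤ ∑ m ∈ Finset.Icc 1 N, ρ m + 4 * N * (k * D) := by
  have hN' : (1 : ℝ) ≤ N := by exact_mod_cast hN
  set q := Real.sqrt N with hq
  have hqq : q ^ 2 = N := Real.sq_sqrt (by positivity)
  have hq1 : 1 ≤ q := by rw [hq]; exact Real.one_le_sqrt.2 hN'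
  have hqN : q ≤ N := by nlinarith
  -- With `√N ≤ J ≤ 2√N`, the left side gains `J ≥ √N`, while the drift costs at most `J² ≤ 4N`
  -- times `k D`.
  set J := ⌈q⌉₊ with hJ
  have hJ1 : q ≤ J := Nat.le_ceil q
  have hJ2 : (J : ℝ) ≤ 2 * q := by
    have := (Nat.ceil_lt_add_one (by linarith : 0 ≤ q)).le
    linarith
  have hJN : J ≤ N := Nat.ceil_le.2 hqN
  have hsub : Finset.Icc 1 J ⊆ Finset.Icc 1 N := Finset.Icc_subset_Icc_right hJN
  have h1 : ∑ m ∈ Finset.Icc 1 J, ρ 0 ≤ ∑ m ∈ Finset.Icc 1 J, (ρ m + J * (k * D)) := by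
    refine Finset.sum_le_sum fun m hm => (hρ m (hsub hm)).trans ?_
    have : (m : ℝ) ≤ J := by exact_mod_cast (Finset.mem_Icc.1 hm).2
    gcongr
  rw [Finset.sum_add_distrib, Finset.sum_const, Finset.sum_const, Nat.card_Icc,
    Nat.add_sub_cancel, nsmul_eq_mul, nsmul_eq_mul] at h1
  have h2 : ∑ m ∈ Finset.Icc 1 J, ρ m ≤ ∑ m ∈ Finset.Icc 1 N, ρ m :=
    Finset.sum_le_sum_of_subset_of_nonneg hsub fun m _ _ => hρ0 m
  have h3 : (J : ℝ) * J ≤ 4 * N := by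
    rw [← hqq]
    nlinarith
  have h4 := mul_le_mul_of_nonneg_right h3 hkD
  have h6 : q * ρ 0 ≤ J * ρ 0 := mul_le_mul_of_nonneg_right hJ1 (hρ0 0)
  linarith

/-- Uses `(ρ + B)² ≤ 2ρ² + 2B²`, the bound of a sum of squares by the square of the sum, and `N + 1
≤ 2N`; the total is `8 X² ≤ 9 X²`. -/
theorem sqrt_sum_sq_le_three_mul {N : ℕ} {B X : ℝ} {ρ x : ℕ → ℝ} (hN : 1 ≤ N) (hB : 0 ≤ B)
    (hρ0 : ∀ m, 0 ≤ ρ m) (hx0 : ∀ m, 0 ≤ x m) (hx : ∀ m ≤ N, x m ≤ ρ m + B) (hρX : ρ 0 ≤ X)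
    (hsX : ∑ m ∈ Finset.Icc 1 N, ρ m ≤ X) (hBX : Real.sqrt N * B ≤ X) :
    Real.sqrt (∑ m ∈ Finset.range (N + 1), x m ^ 2) ≤ 3 * X := by
  have hN' : (1 : ℝ) ≤ N := by exact_mod_cast hN
  have hX0 : 0 ≤ X := (hρ0 0).trans hρX
  refine Real.sqrt_le_iff.2 ⟨by positivity, ?_⟩
  have hx2 : ∑ m ∈ Finset.range (N + 1), x m ^ 2 ≤
      ∑ m ∈ Finset.range (N + 1), (2 * ρ m ^ 2 + 2 * B ^ 2) := by
    refine Finset.sum_le_sum fun m hm => ?_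
    have h1 := hx m (Nat.lt_succ_iff.1 (Finset.mem_range.1 hm))
    have h2 := pow_le_pow_left₀ (hx0 m) h1 2
    have := sq_nonneg (ρ m - B)
    linarith
  have hρ2 : ∑ m ∈ Finset.range (N + 1), ρ m ^ 2 ≤ X ^ 2 + X ^ 2 := by
    rw [Finset.range_eq_Ico, Finset.sum_eq_sum_Ico_succ_bot (by omega)]
    refine add_le_add (pow_le_pow_left₀ (hρ0 0) hρX 2) ?_
    have h1 : ∑ m ∈ Finset.Ico (0 + 1) (N + 1), ρ m ^ 2 ≤
        (∑ m ∈ Finset.Ico (0 + 1) (N + 1), ρ m) ^ 2 :=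
      Finset.sum_sq_le_sq_sum_of_nonneg fun m _ => hρ0 m
    have h2 : Finset.Ico (0 + 1) (N + 1) = Finset.Icc 1 N := by
      ext j; simp only [Finset.mem_Ico, Finset.mem_Icc]; omega
    rw [h2] at h1 ⊢
    exact h1.trans (pow_le_pow_left₀ (Finset.sum_nonneg fun m _ => hρ0 m) hsX 2)
  rw [Finset.sum_add_distrib, ← Finset.mul_sum, Finset.sum_const, Finset.card_range,
    nsmul_eq_mul] at hx2
  have hB2 : N * B ^ 2 ≤ X ^ 2 := by
    have h1 := pow_le_pow_left₀ (by positivity) hBX 2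
    rwa [mul_pow, Real.sq_sqrt (by positivity)] at h1
  have hB3 : B ^ 2 ≤ N * B ^ 2 := le_mul_of_one_le_left (sq_nonneg _) hN'
  push_cast at hx2
  have := sq_nonneg X
  linarith

/-- Summation of the errors over the time levels. -/
theorem sqrt_sum_sq_le {N : ℕ} {k T L M G C η : ℝ} {ρ a x : ℕ → ℝ} (hN : 1 ≤ N) (hk : 0 ≤ k)
    (hkT : N * k = T) (hL : 0 ≤ L) (hM : 0 ≤ M) (hG : 0 ≤ G) (hC : 0 ≤ C) (hη : 0 ≤ η)
    (ha : ∀ m, 0 ≤ a m) (hρ0 : ∀ m, 0 ≤ ρ m) (hx0 : ∀ m, 0 ≤ x m)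
    (hρ : ∀ m ∈ Finset.Icc 1 N, ρ m ≤ η * a m) (hMa : ∀ m ∈ Finset.Icc 1 N, M ≤ G * a m)
    (hρρ : ∀ m ∈ Finset.Icc 1 N, ρ 0 ≤ ρ m + m * (k * (L * M)))
    (hx : ∀ m ≤ N, x m ≤ ρ m + C * (ρ 0 + k * ∑ j ∈ Finset.Icc 1 N, ρ j + k * M)) :
    Real.sqrt (∑ m ∈ Finset.range (N + 1), x m ^ 2) ≤
      3 * ((1 + C) * (1 + T + (1 + 4 * L) * G) * ((∑ m ∈ Finset.Icc 1 N, a m) * (η + k))) := by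
  have hN' : (1 : ℝ) ≤ N := by exact_mod_cast hN
  have hT : 0 ≤ T := by rw [← hkT]; positivity
  set s := ∑ m ∈ Finset.Icc 1 N, a m with hs
  have hs0 : 0 ≤ s := Finset.sum_nonneg fun m _ => ha m
  -- Each level pays for one copy of `M`; this absorbs the terms `k M` after multiplication by `√N ≤
  -- N`.
  have hNM : N * M ≤ G * s := by
    rw [hs, Finset.mul_sum]
    have := Finset.sum_le_sum hMa
    simpa using this
  have hsρ : ∑ j ∈ Finset.Icc 1 N, ρ j ≤ η * s := by
    rw [hs, Finset.mul_sum]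
    exact Finset.sum_le_sum hρ
  have hsρ0 : 0 ≤ ∑ j ∈ Finset.Icc 1 N, ρ j := Finset.sum_nonneg fun m _ => hρ0 m
  have h0 := hρ0 0
  have hqρ := sqrt_mul_le_of_le_add hN (by positivity) hρ0 hρρ
  set ρs := ∑ j ∈ Finset.Icc 1 N, ρ j
  set q := Real.sqrt N with hq
  have hqq : q ^ 2 = N := Real.sq_sqrt (by positivity)
  have hq1 : 1 ≤ q := by rw [hq]; exact Real.one_le_sqrt.2 hN'
  have hqN : q ≤ N := by nlinarith
  have hkNM : k * (N * M) ≤ k * (G * s) := by gcongr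
  have hLkNM : L * (k * (N * M)) ≤ L * (k * (G * s)) := by gcongr
  have s0 : q * ρ 0 ≤ η * s + 4 * (L * (k * (G * s))) := by linarith
  have s1 : q * (k * ρs) ≤ T * (η * s) := by
    rw [← hkT, ← mul_assoc]
    gcongr
  have s2 : q * (k * M) ≤ k * (G * s) := by
    refine le_trans ?_ hkNM
    have : q * (k * M) ≤ N * (k * M) := by gcongr
    linarith
  set Z := (1 + T + (1 + 4 * L) * G) * (s * (η + k)) with hZ
  have hY : η * s + 4 * (L * (k * (G * s))) + T * (η * s) + k * (G * s) ≤ Z := by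
    have r1 : 0 ≤ s * k := by positivity
    have r3 : 0 ≤ T * (s * k) := by positivity
    have r4 : 0 ≤ G * (s * η) := by positivity
    have r5 : 0 ≤ L * (G * (s * η)) := by positivity
    rw [hZ]
    linarith
  have t1 : 0 ≤ T * (η * s) := by positivity
  have t2 : 0 ≤ k * (G * s) := by positivity
  have t3 : 0 ≤ L * (k * (G * s)) := by positivity
  have t4 : 0 ≤ C * Z := by positivity
  have hq0 : ρ 0 ≤ q * ρ 0 := le_mul_of_one_le_left h0 hq1
  rw [mul_assoc (1 + C), ← hZ]
  refine sqrt_sum_sq_le_three_mul hN (by positivity) hρ0 hx0 hx ?_ ?_ ?_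
  · linarith
  · linarith
  · have h1 : q * (ρ 0 + k * ρs + k * M) ≤ Z := by linarith
    have h2 := mul_le_mul_of_nonneg_left h1 hC
    have h3 : 0 ≤ Z := by positivity
    rw [← hq]
    linarith

end

end RosenauBurgers

/-! ### The Rosenau–Burgers problem as an instance of the abstract setting. -/

namespace RosenauBurgers

noncomputable section

variable {n : ℕ} {Ω : Set (E n)}

/-! ### Functions of time with values in Sobolev spaces -/

theorem intervalIntegrable_of_memLp {F : Type*} [NormedAddCommGroup F] {T : ℝ} {p : ENNReal}
    (hT : 0 ≤ T) (hp : 1 ≤ p) {f : ℝ → F} (hf : MemLp f p (timeMeasure T)) {s t : ℝ}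
    (hs : s ∈ Icc 0 T) (ht : t ∈ Icc 0 T) : IntervalIntegrable f volume s t := by
  have : IsFiniteMeasure (timeMeasure T) := by unfold timeMeasure; infer_instance
  have h : IntervalIntegrable f volume 0 T :=
    (intervalIntegrable_iff_integrableOn_Ioo_of_le hT).2 (hf.integrable hp)
  refine h.mono_set ?_
  rw [uIcc_of_le hT]
  exact uIcc_subset_Icc hs ht

theorem ae_of_ae_timeMeasure {T : ℝ} {p : ℝ → Prop} (h : ∀ᵐ t ∂(timeMeasure T), p t) :
    ∀ᵐ t, t ∈ Ioc 0 T → p t := by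
  have h1 := (ae_restrict_iff' measurableSet_Ioo).1 h
  have h2 : ∀ᵐ t : ℝ, t ≠ T := compl_mem_ae_iff.2 (measure_singleton T)
  filter_upwards [h1, h2] with t h1 h2 ht using h1 ⟨ht.1, lt_of_le_of_ne ht.2 h2⟩

theorem uIoc_subset_of_mem {T s t : ℝ} (hs : s ∈ Icc 0 T) (ht : t ∈ Icc 0 T) :
    uIoc s t ⊆ Ioc 0 T :=
  Ioc_subset_Ioc (le_inf hs.1 ht.1) (sup_le hs.2 ht.2)

theorem IsTimeDeriv.eq_add_integral (hΩ : IsOpen Ω) {T : ℝ} {v v' : ℝ → H2 Ω}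
    (h : IsTimeDeriv T v v') (hv' : MemLp v' 2 (timeMeasure T)) {t : ℝ} (ht : t ∈ Icc 0 T) :
    v t = v 0 + ∫ s in (0 : ℝ)..t, v' s := by
  have hT : 0 ≤ T := ht.1.trans ht.2
  refine H2.ext_fn hΩ ?_
  have hi := intervalIntegrable_of_memLp hT (by norm_num) hv' ⟨le_rfl, hT⟩ ht
  have h1 := fnL.intervalIntegral_comp_comm hi
  simp_rw [fnL_apply] at h1
  rw [h t ht, h1]
  exact (fnL.map_add (v 0) (∫ s in (0 : ℝ)..t, v' s)).symm

theorem IsTimeDeriv.sub_eq_integral (hΩ : IsOpen Ω) {T : ℝ} {v v' : ℝ → H2 Ω}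
    (h : IsTimeDeriv T v v') (hv' : MemLp v' 2 (timeMeasure T)) {s t : ℝ} (hs : s ∈ Icc 0 T)
    (ht : t ∈ Icc 0 T) : v t - v s = ∫ τ in s..t, v' τ := by
  have hT : 0 ≤ T := ht.1.trans ht.2
  rw [h.eq_add_integral hΩ hv' ht, h.eq_add_integral hΩ hv' hs, add_sub_add_left_eq_sub]
  exact intervalIntegral.integral_interval_sub_left
    (intervalIntegrable_of_memLp hT (by norm_num) hv' ⟨le_rfl, hT⟩ ht)
    (intervalIntegrable_of_memLp hT (by norm_num) hv' ⟨le_rfl, hT⟩ hs)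

theorem IsTimeDeriv.continuousOn (hΩ : IsOpen Ω) {T : ℝ} (hT : 0 ≤ T) {v v' : ℝ → H2 Ω}
    (h : IsTimeDeriv T v v') (hv' : MemLp v' 2 (timeMeasure T)) : ContinuousOn v (Icc 0 T) := by
  have hi := intervalIntegrable_of_memLp hT (by norm_num) hv' (left_mem_Icc.2 hT)
    (right_mem_Icc.2 hT)
  have h1 := intervalIntegral.continuousOn_primitive_interval (a := 0) (b := T) (f := v')
    (μ := volume) (by
      rw [uIcc_of_le hT]
      exact (intervalIntegrable_iff_integrableOn_Icc_of_le hT).1 hi)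
  rw [uIcc_of_le hT] at h1
  exact (continuousOn_const.add h1).congr fun t ht => h.eq_add_integral hΩ hv' ht

section WeakSolution

variable {α T : ℝ} {u ut : ℝ → H2 Ω} {u0 : H2 Ω}

/-- The distance of `u(t)` from the closed subspace is continuous in `t` and vanishes almost
everywhere, hence everywhere, including both endpoints. -/
theorem IsWeakSolution.mem_H20_of_mem_Icc (hΩ : IsOpen Ω) (hT : 0 < T)
    (h : IsWeakSolution α T u ut u0) {t : ℝ} (ht : t ∈ Icc 0 T) : u t ∈ H20 Ω := by
  have hne : (H20 Ω : Set (H2 Ω)).Nonempty := ⟨0, (H20 Ω).zero_mem⟩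
  have hmem : ∀ v : H2 Ω, v ∈ H20 Ω ↔ Metric.infDist v (H20 Ω : Set (H2 Ω)) = 0 := fun v =>
    isClosed_H20.mem_iff_infDist_zero hne
  have hae : (fun t => Metric.infDist (u t) (H20 Ω : Set (H2 Ω)))
      =ᵐ[volume.restrict (Icc 0 T)] fun _ => 0 := by
    rw [← restrict_Ioo_eq_restrict_Icc]
    filter_upwards [h.mem_H20] with t ht using (hmem _).1 ht
  exact (hmem _).2 (Measure.eqOn_Icc_of_ae_eq volume hT.ne hae
    ((Metric.continuous_infDist_pt _).comp_continuousOn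
      (h.deriv.continuousOn hΩ hT.le h.memLp_ut)) continuousOn_const ht)

/-- The energy map as a linear map. -/
abbrev energyMapₗ (Ω : Set (E n)) : H2 Ω →ₗ[ℝ] WithLp 2 (L2 Ω × L2 Ω) :=
  (energyMap : H2 Ω →L[ℝ] WithLp 2 (L2 Ω × L2 Ω))

theorem exists_isLocLipForm (hn : 1 ≤ n) (hn2 : n ≤ 2) (hΩ : IsOpen Ω)
    (hΩb : Bornology.IsBounded Ω) (hα : 0 ≤ α) :
    ∃ c, IsLocLipForm (energyMapₗ Ω) (H20 Ω) (spatialForm α) c := by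
  obtain ⟨c, hc, h⟩ := exists_abs_spatialForm_sub_le hn hn2 hΩ hΩb hα
  exact ⟨c, hc, h, spatialForm_zero α, fun v hv => spatialForm_self_nonneg hn hn2 hΩ hΩb hα hv⟩

/-- The equation, tested with `χ` and integrated in time, expresses the increment of `u`. The
Lipschitz bound of `b` controls the replacement of `u(τ)` by the fixed `v` for almost every `τ`. -/
theorem IsWeakSolution.isFlow (hn : 1 ≤ n) (hn2 : n ≤ 2) (hΩ : IsOpen Ω)
    (hΩb : Bornology.IsBounded Ω) {c : ℝ} (hT : 0 < T)
    (hb : IsLocLipForm (energyMapₗ Ω) (H20 Ω) (spatialForm α) c)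
    (h : IsWeakSolution α T u ut u0) :
    IsFlow (energyMapₗ Ω) (H20 Ω) (spatialForm α) c T u := by
  obtain ⟨C4, -, h4⟩ := exists_L4_bound hn hn2 hΩ hΩb
  have hcont := h.deriv.continuousOn hΩ hT.le h.memLp_ut
  refine ⟨fun t ht => h.mem_H20_of_mem_Icc hΩ hT ht, ?_, ?_⟩
  · exact isCompact_Icc.exists_bound_of_continuousOn
      ((energyMap (Ω := Ω)).continuous.comp_continuousOn hcont)
  · intro s t hs hst ht v hv χ hχ D hD
    have hsm : s ∈ Icc 0 T := ⟨hs, hst.trans ht⟩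
    have htm : t ∈ Icc 0 T := ⟨hs.trans hst, ht⟩
    have hi := intervalIntegrable_of_memLp hT.le (by norm_num) h.memLp_ut hsm htm
    let ℓ : H2 Ω →L[ℝ] ℝ := (innerSL ℝ (energyMap χ)).comp energyMap
    have hℓ : ∀ w, ℓ w = ⟪energyMap w, energyMap χ⟫ := fun w =>
      real_inner_comm (energyMap w) (energyMap χ)
    have e1 : ⟪energyMap (u t - u s), energyMap χ⟫ = ∫ τ in s..t, ℓ (ut τ) := by
      rw [ℓ.intervalIntegral_comp_comm hi, ← h.deriv.sub_eq_integral hΩ h.memLp_ut hsm htm, hℓ]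
    have e2 : (t - s) * spatialForm α v χ = ∫ _ in s..t, spatialForm α v χ := by
      rw [intervalIntegral.integral_const, smul_eq_mul]
    have hiℓ : IntervalIntegrable (fun τ => ℓ (ut τ)) volume s t :=
      ⟨ℓ.integrable_comp hi.1, ℓ.integrable_comp hi.2⟩
    change |⟪energyMap (u t - u s), energyMap χ⟫ + _| ≤ _
    rw [e1, e2, ← intervalIntegral.integral_add hiℓ intervalIntegrable_const, ← Real.norm_eq_abs]
    have key := intervalIntegral.norm_integral_le_of_norm_le_const_ae (a := s) (b := t)
      (f := fun τ => ℓ (ut τ) + spatialForm α v χ) (C := D * ‖energyMap χ‖) (by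
        filter_upwards [ae_of_ae_timeMeasure h.eqn] with τ hτ hτst
        have hτ0 := uIoc_subset_of_mem hsm htm hτst
        rw [uIoc_of_le hst] at hτst
        obtain ⟨w, hw, hweq⟩ := hτ hτ0
        have hum := h.mem_H20_of_mem_Icc hΩ hT (Ioc_subset_Icc_self hτ0)
        have h1 := hweq χ hχ
        rw [hw.inner_eq hΩ (h4 _ hum).1 hχ] at h1
        have h2 : ℓ (ut τ) = -spatialForm α (u τ) χ := by
          rw [hℓ, inner_energyMap, spatialForm]
          linarith
        rw [h2, neg_add_eq_sub, norm_sub_rev, Real.norm_eq_abs]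
        refine (hb.lip _ hum v hv χ hχ).trans ?_
        exact mul_le_mul_of_nonneg_right (hD τ (Ioc_subset_Icc_self hτst)) (norm_nonneg _))
    refine key.trans (le_of_eq ?_)
    rw [abs_of_nonneg (sub_nonneg.2 hst)]
    change _ = (t - s) * D * ‖energyMap χ‖
    ring

/-- A regular solution has values in `H^r(Ω)`, with bounded norms. -/
theorem exists_Hr_representative {r : ℕ} {utt : ℝ → H2 Ω} (hT : 0 < T)
    (h : IsWeakSolution α T u ut u0) (hreg : IsRegular T r u ut utt u0) :
    ∃ (w : ℝ → Hr r Ω) (B : ℝ), 0 ≤ B ∧ ∀ t ∈ Icc 0 T, fnR (w t) = fn (u t) ∧ ‖w t‖ ≤ B := by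
  obtain ⟨w0, hw0⟩ := hreg.u0_mem_Hr
  obtain ⟨w, hw, hwu⟩ := hreg.ut_mem
  have h0T := left_mem_Icc.2 hT.le
  have hTT := right_mem_Icc.2 hT.le
  -- Integrating `u_t` in `H^r(Ω)` from `u_0` gives a value at every time, as the grid points
  -- require, and a uniform bound.
  refine ⟨fun t => w0 + ∫ s in (0 : ℝ)..t, w s, ‖w0‖ + ∫ s in (0 : ℝ)..T, ‖w s‖, ?_,
    fun t ht => ⟨?_, ?_⟩⟩
  · exact add_nonneg (norm_nonneg _)
      (intervalIntegral.integral_nonneg hT.le fun s _ => norm_nonneg _)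
  · have hi := intervalIntegrable_of_memLp hT.le le_rfl hw h0T ht
    have h1 := (fnRL r).intervalIntegral_comp_comm hi
    rw [h.deriv t ht, h.init, ← hw0]
    have h2 : ∫ s in (0 : ℝ)..t, fn (ut s) = ∫ s in (0 : ℝ)..t, fnRL r (w s) := by
      refine intervalIntegral.integral_congr_ae ?_
      filter_upwards [ae_of_ae_timeMeasure hwu] with s hs hst
      exact (hs (uIoc_subset_of_mem h0T ht hst)).symm
    rw [h2, h1]
    exact (fnRL r).map_add _ _
  · refine (norm_add_le _ _).trans (add_le_add le_rfl ?_)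
    refine (intervalIntegral.norm_integral_le_integral_norm ht.1).trans ?_
    exact intervalIntegral.integral_mono_interval le_rfl ht.1 ht.2
      (Eventually.of_forall fun s => norm_nonneg _)
      (intervalIntegrable_of_memLp hT.le le_rfl hw h0T hTT).norm

end WeakSolution

/-! ### The discrete problem -/

theorem IsBackwardEuler.isScheme (hn : 1 ≤ n) (hn2 : n ≤ 2) (hΩ : IsOpen Ω)
    (hΩb : Bornology.IsBounded Ω) {α k : ℝ} (hk : 0 < k) {N : ℕ} {S : Submodule ℝ (H2 Ω)}
    (hS : S ≤ H20 Ω) {u0 : H2 Ω} {U : ℕ → H2 Ω} (h : IsBackwardEuler α k N S u0 U) :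
    IsScheme (energyMapₗ Ω) S (spatialForm α) k N U := by
  obtain ⟨C4, -, h4⟩ := exists_L4_bound hn hn2 hΩ hΩb
  refine ⟨h.mem, fun m hm χ hχ => ?_⟩
  have h1 := h.step (m + 1) (by omega) (by omega) χ hχ
  rw [integral_g_mul (h4 _ (hS (h.mem _ hm))).1 fun i => EventuallyEq.rfl, neg_neg] at h1
  have e1 : fn (deltaT k U (m + 1)) = k⁻¹ • fn (U (m + 1) - U m) := fnL.map_smul _ _
  have e2 : lap (deltaT k U (m + 1)) = k⁻¹ • lap (U (m + 1) - U m) := lapL.map_smul _ _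
  rw [e1, e2, real_inner_smul_left, real_inner_smul_left] at h1
  change ⟪energyMap (U (m + 1) - U m), energyMap χ⟫ + _ = 0
  rw [inner_energyMap, spatialForm]
  have h2 : k * k⁻¹ = 1 := mul_inv_cancel₀ hk.ne'
  linear_combination k * h1 - (⟪fn (U (m + 1) - U m), fn χ⟫ + ⟪lap (U (m + 1) - U m), lap χ⟫) * h2

/-- Quasi-optimality of the projection `Π_h`. -/
theorem exists_norm_sub_proj_le (hn : 1 ≤ n) (hn2 : n ≤ 2) (hΩ : IsOpen Ω)
    (hΩb : Bornology.IsBounded Ω) :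
    ∃ A : ℝ, 0 ≤ A ∧ ∀ (S : Submodule ℝ (H2 Ω)), S ≤ H20 Ω → ∀ v ∈ H20 Ω, ∀ p, IsProj S v p →
      ∀ φ ∈ S, ‖energyMap (v - p)‖ ≤ A * ‖energyMap (v - φ)‖ := by
  obtain ⟨C, hC, h⟩ := exists_norm_fn_le_lap hn hn2 hΩ hΩb
  refine ⟨1 + C, by positivity, fun S hS v hv p hp φ hφ => ?_⟩
  -- `Π_h` is optimal for `‖Δ ·‖`, and on `H²₀(Ω)` this seminorm controls the energy norm.
  have h1 : ‖lap (v - p)‖ ≤ ‖lap (v - φ)‖ := by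
    refine le_of_sq_le_mul (norm_nonneg _) (norm_nonneg _) ?_
    have h2 := hp.2 (p - φ) (S.sub_mem hp.1 hφ)
    have e : ‖lap (v - p)‖ ^ 2 = ⟪lap (v - φ), lap (v - p)⟫ := by
      have : lap (v - φ) = lap (v - p) + lap (p - φ) := by simp only [lap_sub]; abel
      rw [this, inner_add_left, real_inner_self_eq_norm_sq, real_inner_comm, h2, add_zero]
    rw [e]
    exact real_inner_le_norm _ _
  have h2 := h _ ((H20 Ω).sub_mem hv (hS hp.1))
  have h3 : ‖energyMap (v - p)‖ ≤ (1 + C) * ‖lap (v - p)‖ := by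
    refine le_of_sq_le_sq ?_ (by positivity)
    rw [norm_energyMap_sq]
    have := pow_le_pow_left₀ (norm_nonneg _) h2 2
    nlinarith [mul_nonneg hC (sq_nonneg ‖lap (v - p)‖)]
  have h4 : ‖lap (v - φ)‖ ≤ ‖energyMap (v - φ)‖ := by
    refine le_of_sq_le_sq ?_ (norm_nonneg _)
    rw [norm_energyMap_sq]
    nlinarith [sq_nonneg ‖fn (v - φ)‖]
  exact h3.trans (mul_le_mul_of_nonneg_left (h1.trans h4) (by positivity))

/-- The projection is optimal in the energy norm, which is dominated by the `H²` norm of the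
approximation property. -/
theorem IsApproxSpace.norm_sub_orthProj_le {K h : ℝ} {r : ℕ} {S : Submodule ℝ (H2 Ω)}
    (hS : IsApproxSpace K r h S) {P : H2 Ω → H2 Ω} (hP : IsOrthProj (energyMapₗ Ω) S P)
    {v : H2 Ω} (hv : v ∈ H20 Ω) {w : Hr r Ω} (hw : fnR w = fn v) :
    ‖energyMap (v - P v)‖ ≤ K * h ^ (r - 2) * ‖w‖ := by
  refine le_trans ?_ (hS.approx v hv w hw)
  exact le_ciInf fun φ => (hP.norm_sub_le v φ.2).trans (norm_energyMap_le _)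

end

end RosenauBurgers

/-! ### From bounds at the time levels to the two discrete norms. -/

namespace RosenauBurgers

/-- Combines `sqrt_sum_sq_le` with the equivalence of norms. The nonnegative numbers `I₁` and `I₂`
stand for the two time integrals and merely enlarge the right-hand side. -/
theorem discL2_le_of_bounds {n : ℕ} {Ω : Set (E n)} {N : ℕ} {k T L M G C K H I₁ I₂ : ℝ}
    {ρ a x : ℕ → ℝ} {f : ℕ → H2 Ω} (hN : 1 ≤ N) (hk : 0 ≤ k) (hkT : N * k = T) (hL : 0 ≤ L)
    (hM : 0 ≤ M) (hG : 0 ≤ G) (hC : 0 ≤ C) (hK : 0 ≤ K) (hH : 0 ≤ H) (hI₁ : 0 ≤ I₁)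
    (hI₂ : 0 ≤ I₂) (ha : ∀ m, 0 ≤ a m) (hρ0 : ∀ m, 0 ≤ ρ m) (hx0 : ∀ m, 0 ≤ x m)
    (hρ : ∀ m ∈ Finset.Icc 1 N, ρ m ≤ K * H * a m)
    (hMa : ∀ m ∈ Finset.Icc 1 N, M ≤ G * a m)
    (hρρ : ∀ m ∈ Finset.Icc 1 N, ρ 0 ≤ ρ m + m * (k * (L * M)))
    (hf : ∀ m ≤ N, ‖f m‖ ≤ 2 * x m)
    (hx : ∀ m ≤ N, x m ≤ ρ m + C * (ρ 0 + k * ∑ j ∈ Finset.Icc 1 N, ρ j + k * M)) :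
    discL2 N f ≤ 6 * ((1 + C) * (1 + T + (1 + 4 * L) * G)) * (1 + K) *
      (∑ m ∈ Finset.Icc 1 N, a m + I₁ + I₂) * (H + k) := by
  have hT : 0 ≤ T := by rw [← hkT]; positivity
  have hsum := sqrt_sum_sq_le hN hk hkT hL hM hG hC (mul_nonneg hK hH) ha hρ0 hx0 hρ hMa hρρ hx
  have hdisc : discL2 N f ≤ 2 * Real.sqrt (∑ m ∈ Finset.range (N + 1), x m ^ 2) := by
    rw [discL2]
    refine Real.sqrt_le_iff.2 ⟨by positivity, ?_⟩
    rw [mul_pow, Real.sq_sqrt (Finset.sum_nonneg fun m _ => sq_nonneg _), Finset.mul_sum]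
    refine Finset.sum_le_sum fun m hm => ?_
    rw [← mul_pow]
    exact pow_le_pow_left₀ (norm_nonneg _) (hf m (Nat.lt_succ_iff.1 (Finset.mem_range.1 hm))) 2
  set s := ∑ m ∈ Finset.Icc 1 N, a m
  have hs0 : 0 ≤ s := Finset.sum_nonneg fun m _ => ha m
  set Z := (1 + C) * (1 + T + (1 + 4 * L) * G) with hZ
  have hZ0 : 0 ≤ Z := by positivity
  have hηk : K * H + k ≤ (1 + K) * (H + k) := by
    have : 0 ≤ K * k := by positivity
    linarith
  have hs' : s ≤ s + I₁ + I₂ := by linarith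
  calc discL2 N f ≤ 2 * (3 * (Z * (s * (K * H + k)))) :=
        hdisc.trans (mul_le_mul_of_nonneg_left hsum (by norm_num))
    _ ≤ 2 * (3 * (Z * ((s + I₁ + I₂) * ((1 + K) * (H + k))))) := by gcongr
    _ = _ := by ring

theorem discLinf_le_of_bounds {n : ℕ} {Ω : Set (E n)} {N : ℕ} {k T M C K H B : ℝ}
    {ρ x : ℕ → ℝ} {f : ℕ → H2 Ω} (hk : 0 ≤ k) (hkT : N * k = T) (hM : 0 ≤ M)
    (hC : 0 ≤ C) (hK : 0 ≤ K) (hH : 0 ≤ H) (hB : 0 ≤ B) (hρ : ∀ m ≤ N, ρ m ≤ K * H * B)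
    (hf : ∀ m ≤ N, ‖f m‖ ≤ 2 * x m)
    (hx : ∀ m ≤ N, x m ≤ ρ m + C * (ρ 0 + k * ∑ j ∈ Finset.Icc 1 N, ρ j + k * M)) :
    discLinf N f ≤ (2 * (K * B * (1 + C + C * T)) + 2 * C * M + 1) * (H + k) := by
  have hT : 0 ≤ T := by rw [← hkT]; positivity
  refine Finset.sup'_le _ _ fun m hm => ?_
  have hm' : m ≤ N := Nat.lt_succ_iff.1 (Finset.mem_range.1 hm)
  have hsum : k * ∑ j ∈ Finset.Icc 1 N, ρ j ≤ T * (K * H * B) := by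
    have h3 : ∑ j ∈ Finset.Icc 1 N, ρ j ≤ N * (K * H * B) := by
      refine (Finset.sum_le_sum fun j hj => hρ j (Finset.mem_Icc.1 hj).2).trans ?_
      simp
    refine (mul_le_mul_of_nonneg_left h3 hk).trans (le_of_eq ?_)
    rw [← hkT]; ring
  have h0 := hρ 0 (Nat.zero_le _)
  have h4 : C * (ρ 0 + k * ∑ j ∈ Finset.Icc 1 N, ρ j + k * M) ≤
      C * (K * H * B + T * (K * H * B) + k * M) := by gcongr
  have h5 := hρ m hm'
  have p1 : 0 ≤ K * B * (1 + C + C * T) * k := by positivity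
  have p2 : 0 ≤ C * M * H := by positivity
  have h1 := hf m hm'
  have h2 := hx m hm'
  linarith

end RosenauBurgers

/-! ### Choice of constants and conclusion. -/

open RosenauBurgers in
theorem mainTheorem5 (n : ℕ) (hn : 1 ≤ n) (hn2 : n ≤ 2) (Ω : Set (E n)) (hΩ : IsOpen Ω)
    (hΩb : Bornology.IsBounded Ω) (α : ℝ) (hα : 0 < α) (T : ℝ) (hT : 0 < T)
    (r : ℕ) (hr : 3 < r) (K : ℝ) (hK : 0 < K) (R : ℝ) :
    ∃ K₁ > 0, ∀ (u ut utt : ℝ → H2 Ω) (u0 : H2 Ω),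
      IsWeakSolution α T u ut u0 → IsRegular T r u ut utt u0 → ‖u0‖ ≤ R →
      (∀ (h : ℝ) (S : Submodule ℝ (H2 Ω)) (N : ℕ) (U : ℕ → H2 Ω),
        IsApproxSpace K r h S → 1 ≤ N → IsBackwardEuler α (T / N) N S u0 U →
        discL2 N (fun m => u (m * (T / N)) - U m) ≤
          K₁ * (∑ m ∈ Finset.Icc 1 N, sobNorm r (fn (u (m * (T / N))))
            + (∫ s in (0 : ℝ)..T, sobNorm r (fn (ut s)))
            + ∫ s in (0 : ℝ)..T, ‖utt s‖) * (h ^ (r - 2) + T / N)) ∧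
      ∃ K₂ > 0, ∀ (h : ℝ) (S : Submodule ℝ (H2 Ω)) (N : ℕ) (U : ℕ → H2 Ω),
        IsApproxSpace K r h S → 1 ≤ N → IsBackwardEuler α (T / N) N S u0 U →
        discLinf N (fun m => u (m * (T / N)) - U m) ≤ K₂ * (h ^ (r - 2) + T / N) := by
  obtain ⟨c, hb⟩ := exists_isLocLipForm hn hn2 hΩ hΩb hα.le
  obtain ⟨A, hA, hproj⟩ := exists_norm_sub_proj_le hn hn2 hΩ hΩb
  have hc := hb.c_nonneg
  -- A Lipschitz bound valid at the sizes of both `u` and `U`, uniform over all data with `‖u0‖ ≤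
  -- R`; the absolute value keeps it nonnegative for every real `R`.
  set L : ℝ := c * (1 + |R| + (1 + A) * |R|) with hLdef
  have hL0 : 0 ≤ L := by positivity
  -- The number of time intervals that makes `L T / J ≤ 1/2` in the backward estimate.
  set J : ℕ := ⌈2 * (L * T)⌉₊ + 1 with hJ
  have hJpos : (0 : ℝ) < J := by rw [hJ]; positivity
  have hJL : L * T / J ≤ 1 / 2 := by
    rw [div_le_iff₀ hJpos]
    have := Nat.le_ceil (2 * (L * T))
    rw [hJ]; push_cast; linarith
  -- `2 ^ J` comes from the backward estimate, `1 + 2n` from the comparison of the `H²` and `H^r`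
  -- norms.
  set G : ℝ := 2 ^ J * (1 + 2 * n) with hG
  have hG0 : 0 ≤ G := by positivity
  set C : ℝ := Real.exp (L * T) * (A + L + L * T + L ^ 2 * T * (2 + A)) with hC
  have hC0 : 0 ≤ C := by positivity
  refine ⟨6 * ((1 + C) * (1 + T + (1 + 4 * L) * G)) * (1 + K), by positivity,
    fun u ut utt u0 hu hreg hR => ?_⟩
  have hflow := hu.isFlow hn hn2 hΩ hΩb hT hb
  obtain ⟨w, B, hB0, hw⟩ := exists_Hr_representative hT hu hreg
  have hM0 : ‖energyMap (u 0)‖ ≤ |R| := by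
    rw [hu.init]
    exact (norm_energyMap_le u0).trans (hR.trans (le_abs_self R))
  set M := ‖energyMap (u 0)‖ with hM
  have hMn : 0 ≤ M := norm_nonneg _
  have hL1 : c * (1 + ‖energyMapₗ Ω (u 0)‖ + (1 + A) * ‖energyMapₗ Ω (u 0)‖) ≤ L := by
    change c * (1 + M + (1 + A) * M) ≤ L
    rw [hLdef]; gcongr
  have hL2 : c * (1 + ‖energyMapₗ Ω (u 0)‖) ≤ L := by
    refine le_trans (mul_le_mul_of_nonneg_left ?_ hc) hL1
    change 1 + M ≤ 1 + M + (1 + A) * M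
    have : 0 ≤ (1 + A) * M := by positivity
    linarith
  have hmem0 := hflow.mem
  have hMw : ∀ t ∈ Icc 0 T, M ≤ G * ‖w t‖ := fun t ht => by
    refine (hflow.norm_zero_le hb hL2 (by omega) hJL ht).trans ?_
    rw [hG, mul_assoc]
    refine mul_le_mul_of_nonneg_left ?_ (by positivity)
    exact (norm_energyMap_le (u t)).trans (norm_H2_le_Hr hΩ (by omega) (hw t ht).1)
  have main : ∀ (h : ℝ) (S : Submodule ℝ (H2 Ω)) (N : ℕ) (U : ℕ → H2 Ω),
      IsApproxSpace K r h S → 1 ≤ N → IsBackwardEuler α (T / N) N S u0 U →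
      ∃ ρ : ℕ → ℝ, (∀ m, 0 ≤ ρ m) ∧
        (∀ m ≤ N, (m : ℝ) * (T / N) ∈ Icc 0 T) ∧
        (∀ m ≤ N, ρ m ≤ K * h ^ (r - 2) * ‖w (m * (T / N))‖) ∧
        (∀ m ≤ N, ρ 0 ≤ ρ m + m * (T / N * (L * M))) ∧
        ∀ m ≤ N, ‖u (m * (T / N)) - U m‖ ≤ 2 * ‖energyMap (u (m * (T / N)) - U m)‖ ∧
          ‖energyMap (u (m * (T / N)) - U m)‖ ≤
          ρ m + C * (ρ 0 + T / N * ∑ j ∈ Finset.Icc 1 N, ρ j + T / N * M) := by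
    intro h S N U hS hN hU
    have := hS.finite
    obtain ⟨P, hP⟩ := exists_isOrthProj (energyMapₗ Ω) S
    have hNpos : (0 : ℝ) < N := by exact_mod_cast hN
    have hkT : N * (T / N) = T := by field_simp
    have hkpos : 0 < T / N := by positivity
    have htm : ∀ m ≤ N, (m : ℝ) * (T / N) ∈ Icc 0 T := fun m hm => by
      refine ⟨by positivity, ?_⟩
      have : (m : ℝ) ≤ N := by exact_mod_cast hm
      calc (m : ℝ) * (T / N) ≤ N * (T / N) := by gcongr
        _ = T := hkT
    have h00 : (0 : ℝ) ∈ Icc 0 T := ⟨le_rfl, hT.le⟩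
    have hsch := hU.isScheme hn hn2 hΩ hΩb hkpos hS.le_H20
    have hU0 : ‖energyMapₗ Ω (u 0 - U 0)‖ ≤ A * ‖energyMapₗ Ω (u 0 - P (u 0))‖ :=
      hproj S hS.le_H20 _ (hmem0 0 h00) _ (hu.init ▸ hU.init) _ (hP.mem _)
    refine ⟨fun m => ‖energyMap (u (m * (T / N)) - P (u (m * (T / N))))‖, fun m => norm_nonneg _,
      htm, fun m hm => ?_, fun m hm => ?_, fun m hm => ⟨?_, ?_⟩⟩
    · exact hS.norm_sub_orthProj_le hP (hmem0 _ (htm m hm)) (hw _ (htm m hm)).1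
    · have h1 := hP.norm_sub_le_add (u 0) (u (m * (T / N)))
      have h2 := hflow.norm_sub_le' hb le_rfl (htm m hm).1 (htm m hm).2 hL2
      rw [← neg_sub, map_neg, norm_neg, sub_zero] at h2
      simp only [Nat.cast_zero, zero_mul]
      refine h1.trans (add_le_add le_rfl (h2.trans (le_of_eq ?_)))
      change m * (T / N) * (L * M) = _
      ring
    · exact norm_le_energyMap hΩ ((H20 Ω).sub_mem (hmem0 _ (htm m hm)) (hS.le_H20 (hU.mem m hm)))
    · have := norm_error_le hb hS.le_H20 hN hT.le hkT hflow hsch hP hA hU0 hL1 hm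
      simpa using this
  -- The summand 1 only makes the second constant positive.
  refine ⟨fun h S N U hS hN hU => ?_, 2 * (K * B * (1 + C + C * T)) + 2 * C * M + 1,
    by positivity, fun h S N U hS hN hU => ?_⟩
  · obtain ⟨ρ, hρ0, htm, hρ, hρρ, he⟩ := main h S N U hS hN hU
    have hNpos : (0 : ℝ) < N := by exact_mod_cast hN
    have hkT : N * (T / N) = T := by field_simp
    have hk : 0 ≤ T / N := by positivity
    have hH : 0 ≤ h ^ (r - 2) := pow_nonneg hS.h_pos.le _
    have hsob : ∀ m ≤ N, sobNorm r (fn (u (m * (T / N)))) = ‖w (m * (T / N))‖ := fun m hm =>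
      sobNorm_eq hΩ (hw _ (htm m hm)).1
    refine discL2_le_of_bounds (a := fun m : ℕ => sobNorm r (fn (u (m * (T / N))))) hN hk hkT hL0
      hMn hG0 hC0 hK.le hH (intervalIntegral.integral_nonneg hT.le fun s _ => sobNorm_nonneg _ _)
      (intervalIntegral.integral_nonneg hT.le fun s _ => norm_nonneg _)
      (fun m => sobNorm_nonneg _ _) hρ0 (fun m => norm_nonneg (energyMap (u (m * (T / N)) - U m)))
      (fun m hm => ?_) (fun m hm => ?_) (fun m hm => hρρ m (Finset.mem_Icc.1 hm).2)
      (fun m hm => (he m hm).1) (fun m hm => (he m hm).2)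
    · have hm' := (Finset.mem_Icc.1 hm).2
      rw [hsob m hm']
      exact hρ m hm'
    · have hm' := (Finset.mem_Icc.1 hm).2
      rw [hsob m hm']
      exact hMw _ (htm m hm')
  · obtain ⟨ρ, hρ0, htm, hρ, -, he⟩ := main h S N U hS hN hU
    have hNpos : (0 : ℝ) < N := by exact_mod_cast hN
    have hkT : N * (T / N) = T := by field_simp
    have hk : 0 ≤ T / N := by positivity
    have hH : 0 ≤ h ^ (r - 2) := pow_nonneg hS.h_pos.le _
    exact discLinf_le_of_bounds hk hkT hMn hC0 hK.le hH hB0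
      (fun m hm => (hρ m hm).trans (mul_le_mul_of_nonneg_left (hw _ (htm m hm)).2 (by positivity)))
      (fun m hm => (he m hm).1) (fun m hm => (he m hm).2)
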